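/- Let $V=\mathbb R^8$ with standard basis $(e_i)$ and dual basis $(e^i)$, and write $e^{ijk}=e^i\wedge e^j\wedge e^k$. A 3-form $\varphi\in\Lambda^3V^*$ is called stable if its $GL(V)$-orbit is open in $\Lambda^3V^*$. For $\varphi\in\Lambda^3V^*$ put $$S^\varphi(v,w)=-\sum_{i=1}^8 e_i\otimes\big((v\rfloor\varphi)\wedge(w\rfloor\varphi)\wedge\varphi\wedge e^i\big)\in V\otimes\Lambda^8V^*,\qquad L_v=S^\varphi(v,\cdot),$$ $$B^\varphi(v,w)=\operatorname{Tr}(L_v\circ L_w)\in(\Lambda^8V^*)^{\otimes2}.$$ For $\rho\in\Lambda^8V\setminus\{0\}$, the symmetric bilinear form $\langle v,w\rangle_\varphi=\langle B^\varphi(v,w),\rho^2\rangle$ on $V$ is called a reduced trace form of $\varphi$. Let $$\varphi_1=e^{124}+e^{134}+e^{256}+e^{378}+e^{157}+e^{468},$$ $$\varphi_2=e^{135}+e^{245}+e^{146}-e^{236}+e^{127}+e^{348}+e^{678},$$ $$\varphi_3=e^{135}-e^{146}+e^{236}+e^{245}+e^{347}+e^{568}+e^{127}+e^{128}.$$ The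 Cartan 3-form of a real Lie algebra $\mathfrak g$ is $(X,Y,Z)\mapsto K_{\mathfrak g}([X,Y],Z)$, where $K_{\mathfrak g}$ is the Killing form. **Proposition 3.11.** 1. Let $\varphi$ be a stable 3-form on $V$ and let $\langle\,,\rangle_\varphi$ be any reduced trace form of $\varphi$ (any $\rho\neq0$). Then $\langle\,,\rangle_\varphi$ is non-degenerate, and there is exactly one Lie algebra structure $[\,,]_\varphi$ on $V$ with $$\langle[X,Y]_\varphi,Z\rangle_\varphi=\varphi(X,Y,Z)\qquad(X,Y,Z\in V).$$ 2. The forms $\varphi_1,\varphi_2,\varphi_3$ are stable. 3. For every choice of $\rho\neq0$, the Lie algebras $(V,[\,,]_{\varphi_i})$, $i=1,2,3$, are real forms of $\mathfrak{sl}(3,\mathbb C)$, that is, their complexifications are isomorphic to $\mathfrak{sl}(3,\mathbb C)$. They are non-compact for $i=1,2$ and compact for $i=3$ (compact means that the Killing form is negative definite), and they are isomorphic to $\mathfrak{sl}(3,\mathbb R)$, $\mathfrak{su}(1,2)$ and $\mathfrak{su}(3)$ for $i=1,2,3$ respectively. Moreover $\varphi_i$ is a non-zero real multiple of the Cartan 3-form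 of $(V,[\,,]_{\varphi_i})$. 4. $\varphi_1,\varphi_2,\varphi_3$ are, up to a linear isomorphism, the Cartan 3-forms of $\mathfrak{sl}(3,\mathbb R)$, $\mathfrak{su}(1,2)$, $\mathfrak{su}(3)$ respectively: for each $i$ there is a linear isomorphism $f$ from $V$ onto the $i$-th of these Lie algebras $\mathfrak g$ such that $\varphi_i(X,Y,Z)=K_{\mathfrak g}([f(X),f(Y)],f(Z))$ for all $X,Y,Z\in V$. -/

import Mathlib

namespace StableForm

open scoped TensorProduct Topology

attribute [local instance 100] LieRing.ofAssociativeRing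

noncomputable section

/-- The space `ℝ⁸`. -/
abbrev V : Type := Fin 8 → ℝ

/-- `Λ^k (ℝ⁸)^*`: the alternating `k`-linear forms on `ℝ⁸`. -/
abbrev Form (k : ℕ) : Type := V [⋀^Fin k]→ₗ[ℝ] ℝ

/-- The wedge product of forms, as a bilinear map: the sum over `(m, n)`-shuffles with signs,
so that `(e^1 ∧ … ∧ e^k) (e_1, …, e_k) = 1`. -/
def wedge (m n : ℕ) : Form m →ₗ[ℝ] Form n →ₗ[ℝ] Form (m + n) :=
  TensorProduct.curry
    ((AlternatingMap.domDomCongrₗ ℝ finSumFinEquiv).toLinearMap ∘ₗ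
      LinearMap.compAlternatingMapₗ ℝ (LinearMap.mul' ℝ ℝ) ∘ₗ
        AlternatingMap.domCoprod')

/-- The coordinate 1-forms on `ℝ⁸`; the indices run from `0` to `7`. -/
def coord (i : Fin 8) : Form 1 :=
  AlternatingMap.ofSubsingleton ℝ V ℝ (0 : Fin 1) (LinearMap.proj i)

/-- The monomial 3-form which is the wedge product of the coordinate 1-forms `i`, `j`, `k`. -/
def e (i j k : Fin 8) : Form 3 :=
  wedge 2 1 (wedge 1 1 (coord i) (coord j)) (coord k)

/-- A `k`-form on `ℝ⁸` is stable if its orbit under `GL(8, ℝ)` (acting by pull-back) is open in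
`Λ^k (ℝ⁸)^*` for the natural topology of that finite-dimensional real vector space. -/
def IsStable {k : ℕ} (ω : Form k) : Prop :=
  IsOpen[moduleTopology ℝ (Form k)]
    {ψ : Form k | ∃ g : V ≃ₗ[ℝ] V, ψ = ω.compLinearMap g.toLinearMap}

/-- The natural pairing of an 8-form with an element of `Λ⁸ ℝ⁸`. -/
def pairing (ρ : ⋀[ℝ]^8 V) : Form 8 →ₗ[ℝ] ℝ :=
  LinearMap.applyₗ ρ ∘ₗ (exteriorPower.alternatingMapLinearEquiv (R := ℝ) (M := V) (N := ℝ)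
    (n := 8)).toLinearMap

/-- The 8-form `(v ⌟ ω) ∧ (w ⌟ ω) ∧ ω ∧ e_i^*`. -/
def topForm (ω : Form 3) (v w : V) (i : Fin 8) : Form 8 :=
  wedge 7 1 (wedge 4 3 (wedge 2 2 (ω.curryLeft v) (ω.curryLeft w)) ω) (coord i)

theorem topForm_add_left (ω : Form 3) (v v' w : V) (i : Fin 8) :
    topForm ω (v + v') w i = topForm ω v w i + topForm ω v' w i := by
  unfold topForm
  rw [map_add, map_add, LinearMap.add_apply, map_add, LinearMap.add_apply, map_add,
    LinearMap.add_apply]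

theorem topForm_smul_left (ω : Form 3) (c : ℝ) (v w : V) (i : Fin 8) :
    topForm ω (c • v) w i = c • topForm ω v w i := by
  unfold topForm
  rw [map_smul, map_smul, LinearMap.smul_apply, map_smul, LinearMap.smul_apply, map_smul,
    LinearMap.smul_apply]

theorem topForm_add_right (ω : Form 3) (v w w' : V) (i : Fin 8) :
    topForm ω v (w + w') i = topForm ω v w i + topForm ω v w' i := by
  unfold topForm
  rw [map_add, map_add, map_add, LinearMap.add_apply, map_add, LinearMap.add_apply]

theorem topForm_smul_right (ω : Form 3) (c : ℝ) (v w : V) (i : Fin 8) :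
    topForm ω v (c • w) i = c • topForm ω v w i := by
  unfold topForm
  rw [map_smul, map_smul, map_smul, LinearMap.smul_apply, map_smul, LinearMap.smul_apply]

/-- The reduced multiplication `⟨S^ω, ρ⟩ : ℝ⁸ × ℝ⁸ → ℝ⁸`, that is the bilinear map
`S^ω (v, w) = - ∑ i, e_i ⊗ ((v ⌟ ω) ∧ (w ⌟ ω) ∧ ω ∧ e_i^*)` with values in `ℝ⁸ ⊗ Λ⁸ (ℝ⁸)^*`,
whose second tensor factor is contracted with `ρ ∈ Λ⁸ ℝ⁸`. Here `(e_i)` is the standard basis. -/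
def reducedMul (ω : Form 3) (ρ : ⋀[ℝ]^8 V) : V →ₗ[ℝ] V →ₗ[ℝ] V :=
  LinearMap.mk₂ ℝ (fun v w i => -pairing ρ (topForm ω v w i))
    (fun v v' w => funext fun i => by
      rw [topForm_add_left, map_add, neg_add]; rfl)
    (fun c v w => funext fun i => by
      rw [topForm_smul_left, map_smul, ← smul_neg]; rfl)
    (fun v w w' => funext fun i => by
      rw [topForm_add_right, map_add, neg_add]; rfl)
    (fun c v w => funext fun i => by
      rw [topForm_smul_right, map_smul, ← smul_neg]; rfl)

/-- The reduced trace form `⟨B^ω, ρ²⟩ (v, w) = Tr (L_v ∘ L_w)`, where `L_v` is the reduced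
multiplication by `v`. -/
def reducedTraceForm (ω : Form 3) (ρ : ⋀[ℝ]^8 V) : LinearMap.BilinForm ℝ V :=
  ((LinearMap.mul ℝ (Module.End ℝ V)).compl₁₂ (reducedMul ω ρ) (reducedMul ω ρ)).compr₂
    (LinearMap.trace ℝ V)

/-- A Lie algebra structure on a given real vector space. -/
@[ext]
structure LieStructure (W : Type) [AddCommGroup W] [Module ℝ W] where
  bracket : W →ₗ[ℝ] W →ₗ[ℝ] W
  bracket_self : ∀ x, bracket x x = 0
  jacobi : ∀ x y z,
    bracket x (bracket y z) + bracket y (bracket z x) + bracket z (bracket x y) = 0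

namespace LieStructure

variable {W : Type} [AddCommGroup W] [Module ℝ W]

/-- The vector space `W`, regarded as the Lie algebra given by a Lie algebra structure on it. -/
def Carrier (_L : LieStructure W) : Type := W

instance (L : LieStructure W) : AddCommGroup L.Carrier := inferInstanceAs (AddCommGroup W)

instance (L : LieStructure W) : Module ℝ L.Carrier := inferInstanceAs (Module ℝ W)

/-- The identity map of `W`. -/
def of (L : LieStructure W) : W ≃ₗ[ℝ] L.Carrier := LinearEquiv.refl ℝ W

theorem bracket_swap (L : LieStructure W) (x y : W) : L.bracket x y = -L.bracket y x := by
  have h := L.bracket_self (x + y)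
  simp only [map_add, LinearMap.add_apply, L.bracket_self, zero_add, add_zero] at h
  exact eq_neg_of_add_eq_zero_right h

instance (L : LieStructure W) : LieRing L.Carrier where
  bracket x y := L.of (L.bracket (L.of.symm x) (L.of.symm y))
  add_lie x y z := by simp
  lie_add x y z := by simp
  lie_self x := by simp [L.bracket_self]
  leibniz_lie x y z := by
    simp only [LinearEquiv.symm_apply_apply]
    rw [← map_add]
    congr 1
    have h := L.jacobi (L.of.symm x) (L.of.symm y) (L.of.symm z)
    rw [L.bracket_swap (L.of.symm z) (L.bracket _ _), L.bracket_swap (L.of.symm z) (L.of.symm x),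
      map_neg] at h
    rw [← sub_eq_zero, ← h]
    abel

instance (L : LieStructure W) : LieAlgebra ℝ L.Carrier where
  lie_smul t x y := by
    change L.of (L.bracket (L.of.symm x) (L.of.symm (t • y))) =
      t • L.of (L.bracket (L.of.symm x) (L.of.symm y))
    simp

end LieStructure

/-- The Lie algebra structure `L` on `ℝ⁸` is the one defined by the 3-form `φ` through the
reduced trace form: `⟨[X, Y], Z⟩ = φ (X, Y, Z)`. -/
def IsBracketOf (φ : Form 3) (ρ : ⋀[ℝ]^8 V) (L : LieStructure V) : Prop :=
  ∀ X Y Z : V, reducedTraceForm φ ρ (L.bracket X Y) Z = φ ![X, Y, Z]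

/-- In the notation with indices `1, …, 8`:
`φ₁ = e^{124} + e^{134} + e^{256} + e^{378} + e^{157} + e^{468}`. -/
def φ₁ : Form 3 := e 0 1 3 + e 0 2 3 + e 1 4 5 + e 2 6 7 + e 0 4 6 + e 3 5 7

/-- In the notation with indices `1, …, 8`:
`φ₂ = e^{135} + e^{245} + e^{146} - e^{236} + e^{127} + e^{348} + e^{678}`. -/
def φ₂ : Form 3 := e 0 2 4 + e 1 3 4 + e 0 3 5 - e 1 2 5 + e 0 1 6 + e 2 3 7 + e 5 6 7

/-- In the notation with indices `1, …, 8`: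
`φ₃ = e^{135} - e^{146} + e^{236} + e^{245} + e^{347} + e^{568} + e^{127} + e^{128}`. -/
def φ₃ : Form 3 :=
  e 0 2 4 - e 0 3 5 + e 1 2 5 + e 1 3 4 + e 2 3 6 + e 4 5 7 + e 0 1 6 + e 0 1 7

/-- `sl(3, ℝ)`. -/
abbrev sl3R : LieSubalgebra ℝ (Matrix (Fin 3) (Fin 3) ℝ) :=
  LieAlgebra.SpecialLinear.sl (Fin 3) ℝ

/-- `sl(3, ℂ)`. -/
abbrev sl3C : LieSubalgebra ℂ (Matrix (Fin 3) (Fin 3) ℂ) :=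
  LieAlgebra.SpecialLinear.sl (Fin 3) ℂ

/-- The real Lie algebra of the traceless complex `3 × 3` matrices `A` with `A^* J + J A = 0`. -/
def su (J : Matrix (Fin 3) (Fin 3) ℂ) : LieSubalgebra ℝ (Matrix (Fin 3) (Fin 3) ℂ) where
  carrier := {A | A.conjTranspose * J + J * A = 0 ∧ A.trace = 0}
  zero_mem' := by simp
  add_mem' := by
    rintro A B ⟨hA, hA'⟩ ⟨hB, hB'⟩
    refine ⟨?_, by simp [hA', hB']⟩
    rw [Matrix.conjTranspose_add, add_mul, mul_add, add_add_add_comm, hA, hB, add_zero]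
  smul_mem' := by
    rintro c A ⟨hA, hA'⟩
    refine ⟨?_, by simp [hA']⟩
    rw [Matrix.conjTranspose_smul, star_trivial, smul_mul_assoc, mul_smul_comm, ← smul_add, hA,
      smul_zero]
  lie_mem' := by
    rintro A B ⟨hA, hA'⟩ ⟨hB, hB'⟩
    refine ⟨?_, by rw [Ring.lie_def, Matrix.trace_sub, Matrix.trace_mul_comm, sub_self]⟩
    have hA1 : A.conjTranspose * J = -(J * A) := eq_neg_of_add_eq_zero_left hA
    have hB1 : B.conjTranspose * J = -(J * B) := eq_neg_of_add_eq_zero_left hB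
    rw [Ring.lie_def, Matrix.conjTranspose_sub, Matrix.conjTranspose_mul,
      Matrix.conjTranspose_mul, sub_mul, mul_assoc, mul_assoc, hA1, hB1, mul_neg, mul_neg,
      ← mul_assoc, ← mul_assoc, hA1, hB1]
    noncomm_ring

/-- `su(3)`. -/
abbrev su3 : LieSubalgebra ℝ (Matrix (Fin 3) (Fin 3) ℂ) := su 1

/-- `su(1, 2)`. -/
abbrev su12 : LieSubalgebra ℝ (Matrix (Fin 3) (Fin 3) ℂ) := su (Matrix.diagonal ![1, -1, -1])

section LieAlgebraNotions

variable (𝔤 : Type) [LieRing 𝔤] [LieAlgebra ℝ 𝔤]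

/-- `𝔤` is a real form of `sl(3, ℂ)`: its complexification is isomorphic to `sl(3, ℂ)`. -/
def IsRealFormOfSl3C : Prop := Nonempty ((ℂ ⊗[ℝ] 𝔤) ≃ₗ⁅ℂ⁆ sl3C)

/-- A real semisimple Lie algebra is compact if its Killing form is negative definite. -/
def IsCompactLie : Prop := ∀ x : 𝔤, x ≠ 0 → killingForm ℝ 𝔤 x x < 0

/-- The Cartan 3-form `(X, Y, Z) ↦ ⟨[X, Y], Z⟩` of a Lie algebra, with the Killing form. -/
def cartanForm (X Y Z : 𝔤) : ℝ := killingForm ℝ 𝔤 ⁅X, Y⁆ Z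

/-- The 3-form `φ` on `ℝ⁸` becomes the Cartan 3-form of `𝔤` under some linear isomorphism
`ℝ⁸ ≃ 𝔤`. -/
def IsEquivalentToCartanForm (φ : Form 3) : Prop :=
  ∃ f : V ≃ₗ[ℝ] 𝔤, ∀ X Y Z : V, φ ![X, Y, Z] = cartanForm 𝔤 (f X) (f Y) (f Z)

end LieAlgebraNotions

/-- Up to a non-zero factor, `φ` is the Cartan 3-form of the Lie algebra structure `L` on `ℝ⁸`. -/
def IsMultipleOfCartanForm (φ : Form 3) (L : LieStructure V) : Prop :=
  ∃ c : ℝ, c ≠ 0 ∧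
    ∀ X Y Z : V, φ ![X, Y, Z] = c * cartanForm L.Carrier (L.of X) (L.of Y) (L.of Z)

end

end StableForm

open StableForm

namespace StableForm

open scoped TensorProduct Topology

attribute [local instance 100] LieRing.ofAssociativeRing
attribute [local instance 2000] LinearEquiv.instEquivLike

/-! No classification of stable forms is needed; a single model suffices. The Gram determinant of
the reduced trace form is a polynomial in the 3-form. So is the Jacobi expression, once the bracket
is multiplied by that determinant, so that the inverse Gram matrix is replaced by the adjugate. Both
are equivariant under `GL(V)`: pull-back by `g` multiplies the trace form by `det g ^ 2` and carries
the bracket to a multiple of its transport. If a stable form were degenerate, the Gram determinant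
would vanish on an open orbit, hence everywhere by the identity theorem, contrary to its value at
`φ₁`. In the same way, the Jacobi identity holds on the open orbit of `φ₁`, hence in polynomial form
for all 3-forms, and a stable form allows division by the determinant
(`IsStable.existsUnique_isBracketOf`).

Stability of the three forms is a dimension count. The derivative at the identity of `A ↦ A^* φ`
maps a space of dimension 64 to one of dimension 56, so it is onto as soon as its kernel has
dimension at most 8. A kernel element `A` preserves the trace form up to the factor `-2 tr A`;
contraction with the inverse Gram matrix forces `tr A = 0`. Hence `A` is skew for the Killing form
and kills the Cartan 3-form, so it is a derivation. Derivations of a Lie algebra with non-degenerate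
Killing form are inner, and the inner ones span a space of dimension at most 8
(`isStable_of_cartanForm`).

What remains is explicit. Integer tables give the trace forms of `φ₁`, `φ₂`, `φ₃`, and coordinates
on spaces of `3 × 3` matrices turn `φᵢ` and its trace form into multiples of `tr ([X, Y] Z)` and `tr
(X Y)`, thus of the Cartan 3-form and the Killing form (`CartanModel`). The bracket defined by `φᵢ`
is then a non-zero multiple of the matrix commutator, and a homothety absorbs the factor. -/

theorem wedge_apply_eq (m n : ℕ) (a : Form m) (b : Form n) :
    wedge m n a b = ((LinearMap.mul' ℝ ℝ).compAlternatingMap (a.domCoprod b)).domDomCongr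
      finSumFinEquiv := rfl

theorem wedge_compLinearMap (m n : ℕ) (a : Form m) (b : Form n) (g : V →ₗ[ℝ] V) :
    wedge m n (a.compLinearMap g) (b.compLinearMap g) = (wedge m n a b).compLinearMap g := by
  ext v
  simp only [wedge_apply_eq, AlternatingMap.domDomCongr_apply, AlternatingMap.compLinearMap_apply,
    LinearMap.compAlternatingMap_apply, AlternatingMap.domCoprod_apply, sum_apply]
  congr 1
  refine Finset.sum_congr rfl fun σ _ => ?_
  induction σ using Quotient.inductionOn' with
  | h σ =>
    simp only [AlternatingMap.domCoprod.summand_mk'', MultilinearMap.domDomCongr_apply,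
      MultilinearMap.domCoprod_apply, smul_apply]
    rfl

/-! ### Coordinate monomials and 8-forms -/

/-- The multilinear form `v ↦ ∏ j, v j (l j)`. -/
noncomputable def multiMono {k : ℕ} (l : Fin k → Fin 8) : MultilinearMap ℝ (fun _ : Fin k => V) ℝ :=
  (MultilinearMap.mkPiAlgebra ℝ (Fin k) ℝ).compLinearMap fun j => LinearMap.proj (l j)

/-- The wedge product of the coordinate 1-forms `l 0`, …, `l (k - 1)`. -/
noncomputable def mono {k : ℕ} (l : Fin k → Fin 8) : Form k :=
  MultilinearMap.alternatization (multiMono l)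

theorem mono_apply {k : ℕ} (l : Fin k → Fin 8) (v : Fin k → V) :
    mono l v = Matrix.det (Matrix.of fun i j => v i (l j)) := by
  rw [Matrix.det_apply]
  simp [mono, multiMono, MultilinearMap.alternatization_apply]

/-- The shuffle product of two alternatizations is the alternatization of the tensor product, so
both sides are signed sums over all permutations of `m + n` letters, matched along `finSumFinEquiv`.
-/
theorem mono_finAppend {m n : ℕ} (l : Fin m → Fin 8) (l' : Fin n → Fin 8) :
    wedge m n (mono l) (mono l') = mono (Fin.append l l') := by
  ext v
  rw [wedge_apply_eq, mono, mono, ← MultilinearMap.domCoprod_alternization,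
    AlternatingMap.domDomCongr_apply, LinearMap.compAlternatingMap_apply,
    MultilinearMap.alternatization_apply, map_sum, mono, MultilinearMap.alternatization_apply]
  refine Fintype.sum_equiv finSumFinEquiv.permCongr _ _ fun σ => ?_
  rw [Equiv.Perm.sign_permCongr]
  rw [Units.smul_def, Units.smul_def, map_zsmul]
  congr 1
  simp [multiMono, Fin.prod_univ_add, Function.comp_def]

theorem coord_eq_mono (i : Fin 8) : coord i = mono ![i] := by
  ext v
  rw [mono_apply]
  simp [coord]

theorem e_eq_mono (i j k : Fin 8) : e i j k = mono ![i, j, k] := by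
  rw [e, coord_eq_mono, coord_eq_mono, coord_eq_mono, mono_finAppend, mono_finAppend]
  congr 1
  ext x
  fin_cases x <;> rfl

theorem curryLeft_mono3 (i j k : Fin 8) (v : V) :
    (mono ![i, j, k]).curryLeft v =
      v i • mono ![j, k] - v j • mono ![i, k] + v k • mono ![i, j] := by
  ext u
  simp only [AlternatingMap.curryLeft_apply_apply, mono_apply, AlternatingMap.add_apply,
    AlternatingMap.sub_apply, AlternatingMap.smul_apply, smul_eq_mul]
  rw [Matrix.det_fin_three, Matrix.det_fin_two, Matrix.det_fin_two, Matrix.det_fin_two]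
  simp only [Matrix.of_apply, Matrix.cons_val_zero, Matrix.cons_val_one, Matrix.cons_val]
  ring

theorem compLinearMap_form8 (ω : Form 8) (g : V →ₗ[ℝ] V) :
    ω.compLinearMap g = LinearMap.det g • ω := by
  have h := ω.eq_smul_basis_det (Pi.basisFun ℝ (Fin 8))
  ext v
  rw [h]
  simp only [AlternatingMap.compLinearMap_apply, AlternatingMap.smul_apply, smul_eq_mul]
  have := (Pi.basisFun ℝ (Fin 8)).det_comp g v
  simp only [Function.comp_def] at this
  rw [this]; ring

/-- The value of an 8-form on the standard basis. -/
noncomputable def vol (ω : Form 8) : ℝ := ω (Pi.basisFun ℝ (Fin 8))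

/-- The scalar by which the contraction with `ρ` differs from `vol`. -/
noncomputable def scale (ρ : ⋀[ℝ]^8 V) : ℝ := pairing ρ (Pi.basisFun ℝ (Fin 8)).det

/-- Since 8-forms are a line, `ρ` enters every later formula only through the number `scale ρ`. -/
theorem pairing_eq (ρ : ⋀[ℝ]^8 V) (ω : Form 8) : pairing ρ ω = scale ρ * vol ω := by
  conv_lhs => rw [ω.eq_smul_basis_det (Pi.basisFun ℝ (Fin 8))]
  rw [map_smul, smul_eq_mul, mul_comm]
  rfl

theorem scale_ne_zero {ρ : ⋀[ℝ]^8 V} (hρ : ρ ≠ 0) : scale ρ ≠ 0 := by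
  intro h
  apply hρ
  rw [← Module.forall_dual_apply_eq_zero_iff ℝ]
  intro f
  obtain ⟨ω, rfl⟩ := (exteriorPower.alternatingMapLinearEquiv (R := ℝ) (M := V) (N := ℝ)
    (n := 8)).surjective f
  have := pairing_eq ρ ω
  rw [h, zero_mul] at this
  exact this

/-- The matrix is a permutation matrix, or has two equal columns. The sign is written as a product
over pairs so that it can be evaluated on lists of indices. -/
theorem vol_mono (l : Fin 8 → Fin 8) :
    vol (mono l) = ((∏ i, ∏ j ∈ Finset.Ioi i, if l i = l j then 0 else
      if l i < l j then 1 else -1 : ℤ) : ℝ) := by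
  rw [vol, mono_apply]
  by_cases hl : Function.Injective l
  · obtain ⟨σ, hσ⟩ : ∃ σ : Equiv.Perm (Fin 8), ⇑σ = l :=
      ⟨Equiv.ofBijective l (Finite.injective_iff_bijective.mp hl), rfl⟩
    subst hσ
    have h1 : (Matrix.of fun i j => (Pi.basisFun ℝ (Fin 8)) i (σ j)) =
        ((σ⁻¹).permMatrix ℝ) := by
      ext i j
      simp [Equiv.Perm.permMatrix, PEquiv.toMatrix_apply, Pi.single_apply, Equiv.eq_symm_apply,
        eq_comm]
    rw [h1, Matrix.det_permutation, Equiv.Perm.sign_inv, Equiv.Perm.sign_eq_prod_prod_Ioi]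
    push_cast
    refine Finset.prod_congr rfl fun i _ => Finset.prod_congr rfl fun j hj => ?_
    have : i ≠ j := (Finset.mem_Ioi.mp hj).ne
    simp only [EmbeddingLike.apply_eq_iff_eq, this, if_false]
    split_ifs <;> simp
  · have : ∃ i j, i < j ∧ l i = l j := by
      simp only [Function.Injective, not_forall] at hl
      obtain ⟨i, j, h, hne⟩ := hl
      rcases lt_or_gt_of_ne hne with h' | h'
      · exact ⟨i, j, h', h⟩
      · exact ⟨j, i, h', h.symm⟩
    obtain ⟨i, j, hij, h⟩ := this
    rw [Matrix.det_zero_of_column_eq hij.ne (fun k => by simp [h])]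
    symm
    rw [Finset.prod_eq_zero (Finset.mem_univ i)
      (Finset.prod_eq_zero (Finset.mem_Ioi.mpr hij) (by simp [h]))]
    simp

/-! ### Equivariance -/

theorem reducedMul_apply_eq_pairing (ω : Form 3) (ρ : ⋀[ℝ]^8 V) (v w : V) (i : Fin 8) :
    reducedMul ω ρ v w i = -pairing ρ (topForm ω v w i) := rfl

theorem reducedMul_apply (ω : Form 3) (ρ : ⋀[ℝ]^8 V) (v w : V) (i : Fin 8) :
    reducedMul ω ρ v w i = -(scale ρ * vol (topForm ω v w i)) := by
  rw [← pairing_eq, reducedMul_apply_eq_pairing]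

theorem reducedTraceForm_apply (ω : Form 3) (ρ : ⋀[ℝ]^8 V) (v w : V) :
    reducedTraceForm ω ρ v w =
      LinearMap.trace ℝ V (reducedMul ω ρ v ∘ₗ reducedMul ω ρ w) := by
  rw [reducedTraceForm, LinearMap.compr₂_apply, LinearMap.compl₁₂_apply, LinearMap.mul_apply',
    Module.End.mul_eq_comp]

theorem reducedTraceForm_comm (ω : Form 3) (ρ : ⋀[ℝ]^8 V) (v w : V) :
    reducedTraceForm ω ρ v w = reducedTraceForm ω ρ w v := by
  rw [reducedTraceForm_apply, reducedTraceForm_apply, LinearMap.trace_comp_comm']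

theorem reducedTraceForm_eq_sum (ω : Form 3) (ρ : ⋀[ℝ]^8 V) (v w : V) :
    reducedTraceForm ω ρ v w = ∑ i, ∑ j,
      reducedMul ω ρ v (Pi.single j 1) i * reducedMul ω ρ w (Pi.single i 1) j := by
  rw [reducedTraceForm_apply, LinearMap.trace_eq_matrix_trace ℝ (Pi.basisFun ℝ (Fin 8)),
    LinearMap.toMatrix_comp _ (Pi.basisFun ℝ (Fin 8))]
  simp [Matrix.trace, Matrix.mul_apply]

/-- Evaluation of forms, as a linear map. -/
noncomputable def evalForm {k : ℕ} (v : Fin k → V) : Form k →ₗ[ℝ] ℝ where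
  toFun ω := ω v
  map_add' _ _ := rfl
  map_smul' _ _ := rfl

theorem evalForm_apply {k : ℕ} (v : Fin k → V) (ω : Form k) : evalForm v ω = ω v := rfl

theorem coord_apply (i : Fin 8) (v : Fin 1 → V) : coord i v = v 0 i := rfl

theorem coord_compLinearMap (j : Fin 8) (g : V →ₗ[ℝ] V) :
    (coord j).compLinearMap g = ∑ i, g (Pi.single i 1) j • coord i := by
  ext v
  have h : v 0 = ∑ i, v 0 i • (Pi.single i 1 : V) := by
    ext k; simp [Finset.sum_apply, Pi.single_apply]
  rw [AlternatingMap.compLinearMap_apply, coord_apply, ← evalForm_apply v (∑ i, _), map_sum]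
  simp only [map_smul, evalForm_apply, coord_apply, smul_eq_mul]
  conv_lhs => rw [h]
  simp [map_sum, Finset.sum_apply, mul_comm]

/-- Equivariance of the reduced multiplication, for an arbitrary endomorphism. -/
theorem map_reducedMul_compLinearMap (ω : Form 3) (ρ : ⋀[ℝ]^8 V) (g : V →ₗ[ℝ] V) (v w : V) :
    g (reducedMul (ω.compLinearMap g) ρ v w) =
      LinearMap.det g • reducedMul ω ρ (g v) (g w) := by
  ext j
  set u := reducedMul (ω.compLinearMap g) ρ v w with hu
  have h : u = ∑ i, u i • (Pi.single i 1 : V) := by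
    ext k; simp [Finset.sum_apply, Pi.single_apply]
  -- Expanding the pull-back of the `j`-th coordinate in the coordinate forms gives `j`-th
  -- coordinates of `g u`. All factors are then pull-backs, and so is the 8-form, which contributes
  -- `det g`. No inverse of `g` is used.
  have h1 : g u j = -pairing ρ (wedge 7 1 (wedge 4 3 (wedge 2 2
      ((ω.compLinearMap g).curryLeft v) ((ω.compLinearMap g).curryLeft w))
      (ω.compLinearMap g)) ((coord j).compLinearMap g)) := by
    rw [coord_compLinearMap, map_sum, map_sum, ← Finset.sum_neg_distrib]
    conv_lhs => rw [h, map_sum, Finset.sum_apply]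
    refine Finset.sum_congr rfl fun i _ => ?_
    rw [map_smul, map_smul, map_smul, Pi.smul_apply, smul_eq_mul, smul_eq_mul, mul_comm,
      ← mul_neg, hu, reducedMul_apply_eq_pairing, topForm]
  rw [h1, AlternatingMap.curryLeft_compLinearMap, AlternatingMap.curryLeft_compLinearMap,
    wedge_compLinearMap, wedge_compLinearMap, wedge_compLinearMap, compLinearMap_form8, map_smul,
    ← smul_neg, Pi.smul_apply, reducedMul_apply_eq_pairing, topForm]

/-- Left multiplications are conjugated by `g` and multiplied by `det g`; the trace ignores the
conjugation and sees two such factors. -/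
theorem reducedTraceForm_compLinearMap (ω : Form 3) (ρ : ⋀[ℝ]^8 V) (g : V ≃ₗ[ℝ] V) (v w : V) :
    reducedTraceForm (ω.compLinearMap g.toLinearMap) ρ v w =
      LinearMap.det g.toLinearMap ^ 2 * reducedTraceForm ω ρ (g v) (g w) := by
  have h : ∀ v, reducedMul (ω.compLinearMap g.toLinearMap) ρ v =
      LinearMap.det g.toLinearMap • g.symm.conj (reducedMul ω ρ (g v)) := by
    intro v
    refine LinearMap.ext fun x => ?_
    apply g.injective
    rw [LinearMap.smul_apply, map_smul, LinearEquiv.conj_apply_apply, g.apply_symm_apply,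
      LinearEquiv.symm_symm]
    have := map_reducedMul_compLinearMap ω ρ g.toLinearMap v x
    simp only [LinearEquiv.coe_coe] at this ⊢
    rw [this]
  rw [reducedTraceForm_apply, reducedTraceForm_apply, h, h, LinearMap.smul_comp,
    LinearMap.comp_smul, smul_smul, ← LinearEquiv.conj_comp, map_smul,
    LinearMap.trace_conj', smul_eq_mul, sq]

/-! ### Topology on the space of forms -/

instance finite_form (k : ℕ) : Module.Finite ℝ (Form k) :=
  Module.Finite.equiv (exteriorPower.alternatingMapLinearEquiv (R := ℝ) (M := V) (N := ℝ)
    (n := k)).symm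

/-- The values of a form on the tuples of standard basis vectors. -/
noncomputable def coeffs (k : ℕ) : Form k →ₗ[ℝ] ((Fin k → Fin 8) → ℝ) where
  toFun ω s := ω fun i => Pi.single (s i) 1
  map_add' _ _ := rfl
  map_smul' _ _ := rfl

theorem coeffs_injective (k : ℕ) : Function.Injective (coeffs k) := fun a b h =>
  (Pi.basisFun ℝ (Fin 8)).ext_alternating fun s _ => by
    simpa [coeffs] using congrFun h s

/-- An auxiliary norm that makes differential calculus available. In finite dimension its topology
is the module topology in the definition of stability, see `isStable_iff`. -/
noncomputable abbrev normedForm (k : ℕ) : NormedAddCommGroup (Form k) :=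
  NormedAddCommGroup.induced _ _ (coeffs k) (coeffs_injective k)

attribute [local instance] normedForm

noncomputable abbrev normedSpaceForm (k : ℕ) : NormedSpace ℝ (Form k) :=
  NormedSpace.induced ℝ _ _ (coeffs k)

attribute [local instance] normedSpaceForm

theorem isStable_iff {k : ℕ} (ω : Form k) : IsStable ω ↔
    IsOpen {ψ : Form k | ∃ g : V ≃ₗ[ℝ] V, ψ = ω.compLinearMap g.toLinearMap} := by
  have : IsModuleTopology ℝ (Form k) := isModuleTopologyOfFiniteDimensional
  rw [IsStable, ← eq_moduleTopology ℝ (Form k)]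

theorem analyticAt_linear {k : ℕ} {F : Type*} [NormedAddCommGroup F] [NormedSpace ℝ F]
    (f : Form k →ₗ[ℝ] F) {E : Type*} [NormedAddCommGroup E] [NormedSpace ℝ E] {c : E → Form k}
    {x : E} (hc : AnalyticAt ℝ c x) : AnalyticAt ℝ (fun x => f (c x)) x :=
  (ContinuousLinearMap.analyticAt (LinearMap.toContinuousLinearMap f) (c x)).comp hc

theorem analyticAt_wedge {m n : ℕ} {E : Type*} [NormedAddCommGroup E] [NormedSpace ℝ E]
    {a : E → Form m} {b : E → Form n} {x : E} (ha : AnalyticAt ℝ a x) (hb : AnalyticAt ℝ b x) :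
    AnalyticAt ℝ (fun x => wedge m n (a x) (b x)) x :=
  (ContinuousLinearMap.analyticAt_bilinear (wedge m n).toContinuousBilinearMap
    (a x, b x)).comp (f := fun x => (a x, b x)) (ha.prod hb)

theorem analyticAt_reducedMul (ρ : ⋀[ℝ]^8 V) (v w : V) (i : Fin 8) (ω : Form 3) :
    AnalyticAt ℝ (fun ω => reducedMul ω ρ v w i) ω := by
  have hc : ∀ v, AnalyticAt ℝ (fun ω : Form 3 => ω.curryLeft v) ω := fun v =>
    analyticAt_linear ((LinearMap.applyₗ v) ∘ₗ
      (AlternatingMap.curryLeftLinearMap : Form 3 →ₗ[ℝ] V →ₗ[ℝ] Form 2)) analyticAt_id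
  simp only [reducedMul_apply_eq_pairing, topForm]
  exact (analyticAt_linear (pairing ρ) (analyticAt_wedge (analyticAt_wedge
    (analyticAt_wedge (hc v) (hc w)) analyticAt_id) analyticAt_const)).neg

theorem analyticAt_reducedTraceForm (ρ : ⋀[ℝ]^8 V) (v w : V) (ω : Form 3) :
    AnalyticAt ℝ (fun ω => reducedTraceForm ω ρ v w) ω := by
  simp only [reducedTraceForm_eq_sum]
  exact Finset.analyticAt_fun_sum _ fun i _ => Finset.analyticAt_fun_sum _ fun j _ =>
    (analyticAt_reducedMul _ _ _ _ _).mul (analyticAt_reducedMul _ _ _ _ _)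

theorem analyticAt_det {E : Type*} [NormedAddCommGroup E] [NormedSpace ℝ E]
    {n : Type*} [Fintype n] [DecidableEq n] {A : E → Matrix n n ℝ} {x : E}
    (h : ∀ i j, AnalyticAt ℝ (fun x => A x i j) x) : AnalyticAt ℝ (fun x => (A x).det) x := by
  simp only [Matrix.det_apply']
  exact Finset.analyticAt_fun_sum _ fun σ _ => analyticAt_const.mul
    (Finset.analyticAt_fun_prod _ fun i _ => h _ _)

/-- The Gram matrix of the reduced trace form. -/
noncomputable def gram (ω : Form 3) (ρ : ⋀[ℝ]^8 V) : Matrix (Fin 8) (Fin 8) ℝ :=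
  LinearMap.BilinForm.toMatrix' (reducedTraceForm ω ρ)

theorem gram_apply (ω : Form 3) (ρ : ⋀[ℝ]^8 V) (i j : Fin 8) :
    gram ω ρ i j = reducedTraceForm ω ρ (Pi.single i 1) (Pi.single j 1) := by
  simp [gram, LinearMap.BilinForm.toMatrix'_apply]

theorem nondegenerate_iff_det_gram (ω : Form 3) (ρ : ⋀[ℝ]^8 V) :
    (reducedTraceForm ω ρ).Nondegenerate ↔ (gram ω ρ).det ≠ 0 := by
  rw [gram, ← Matrix.nondegenerate_iff_det_ne_zero,
    LinearMap.BilinForm.nondegenerate_toMatrix'_iff]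

theorem analyticAt_gram (ρ : ⋀[ℝ]^8 V) (i j : Fin 8) (ω : Form 3) :
    AnalyticAt ℝ (fun ω => gram ω ρ i j) ω := by
  simp only [gram_apply]
  exact analyticAt_reducedTraceForm _ _ _ _

theorem analyticAt_adjugate_gram (ρ : ⋀[ℝ]^8 V) (i j : Fin 8) (ω : Form 3) :
    AnalyticAt ℝ (fun ω => (gram ω ρ).adjugate i j) ω := by
  simp only [Matrix.adjugate_apply]
  refine analyticAt_det fun k l => ?_
  by_cases hk : k = j
  · subst hk; simpa using analyticAt_const
  · simpa [Matrix.updateRow_ne hk] using analyticAt_gram ρ k l ω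

theorem nondegenerate_compLinearMap {ω : Form 3} {ρ : ⋀[ℝ]^8 V}
    (h : (reducedTraceForm ω ρ).Nondegenerate) (g : V ≃ₗ[ℝ] V) :
    (reducedTraceForm (ω.compLinearMap g.toLinearMap) ρ).Nondegenerate := by
  refine LinearMap.BilinForm.Nondegenerate.ofSeparatingLeft fun x hx => ?_
  apply g.injective
  rw [map_zero]
  refine h.1 _ fun y => ?_
  have := hx (g.symm y)
  rw [reducedTraceForm_compLinearMap, g.apply_symm_apply] at this
  have hd : LinearMap.det g.toLinearMap ≠ 0 := g.isUnit_det'.ne_zero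
  exact (mul_eq_zero.mp this).resolve_left (pow_ne_zero 2 hd)

/-- If the reduced trace form of some 3-form is non-degenerate, so is that of any stable one. -/
theorem IsStable.nondegenerate {φ ω : Form 3} (hφ : IsStable φ) {ρ : ⋀[ℝ]^8 V}
    (hω : (reducedTraceForm ω ρ).Nondegenerate) : (reducedTraceForm φ ρ).Nondegenerate := by
  by_contra hdeg
  rw [isStable_iff] at hφ
  rw [nondegenerate_iff_det_gram] at hω
  apply hω
  -- Degeneracy spreads from `φ` over its whole orbit, which is a neighbourhood of `φ`.
  have h0 : (fun ω => (gram ω ρ).det) =ᶠ[𝓝 φ] fun _ => 0 := by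
    filter_upwards [hφ.mem_nhds ⟨LinearEquiv.refl ℝ V, by ext; rfl⟩] with ψ hψ
    obtain ⟨g, hg⟩ := hψ
    by_contra hne
    apply hdeg
    have := nondegenerate_compLinearMap ((nondegenerate_iff_det_gram ψ ρ).mpr hne) g.symm
    convert this
    subst hg
    ext v
    simp
  -- Identity theorem: a function analytic on the whole vector space that vanishes near `φ` vanishes
  -- at `ω`.
  exact congrFun (AnalyticOnNhd.eq_of_eventuallyEq (fun ω _ => analyticAt_det
    fun i j => analyticAt_gram ρ i j ω) (fun _ _ => analyticAt_const) h0) ω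

/-! ### The bracket of a stable form -/

/-- A 3-form as a trilinear map. -/
noncomputable def trilinear (ω : Form 3) : V →ₗ[ℝ] V →ₗ[ℝ] V →ₗ[ℝ] ℝ :=
  LinearMap.mk₂ ℝ (fun X Y => evalForm ![] ∘ₗ ((ω.curryLeft X).curryLeft Y).curryLeft)
    (fun X X' Y => by ext; simp [evalForm_apply])
    (fun c X Y => by ext; simp [evalForm_apply])
    (fun X Y Y' => by ext; simp [evalForm_apply])
    (fun c X Y => by ext; simp [evalForm_apply])

theorem trilinear_apply (ω : Form 3) (X Y Z : V) : trilinear ω X Y Z = ω ![X, Y, Z] := rfl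

theorem form_self (ω : Form 3) (X Z : V) : ω ![X, X, Z] = 0 :=
  ω.map_eq_zero_of_eq _ (i := 0) (j := 1) rfl (by decide)

/-- The candidate for the bracket, multiplied by the determinant of the trace form. -/
noncomputable def scaledBracket (ρ : ⋀[ℝ]^8 V) (ω : Form 3) (X Y : V) : V :=
  (gram ω ρ).adjugate.mulVec fun q => ω ![X, Y, Pi.single q 1]

theorem scaledBracket_eq_sum (ρ : ⋀[ℝ]^8 V) (ω : Form 3) (X Y : V) :
    scaledBracket ρ ω X Y = ∑ k, Y k • scaledBracket ρ ω X (Pi.single k 1) := by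
  have h : (fun q => ω ![X, Y, Pi.single q 1]) =
      ∑ k, Y k • fun q => ω ![X, Pi.single k 1, Pi.single q 1] := by
    ext q
    have hY : Y = ∑ k, Y k • (Pi.single k 1 : V) := by
      ext j; simp [Finset.sum_apply, Pi.single_apply]
    simp only [← trilinear_apply]
    conv_lhs => rw [hY]
    simp [map_sum, Finset.sum_apply]
  rw [scaledBracket, h, Matrix.mulVec_sum]
  simp only [Matrix.mulVec_smul, scaledBracket]

/-- The adjugate, unlike the inverse, is polynomial also where the Gram matrix is singular, so the
identity theorem can be applied on all of `Form 3`. -/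
theorem analyticAt_scaledBracket (ρ : ⋀[ℝ]^8 V) (X Y : V) (i : Fin 8) (ω : Form 3) :
    AnalyticAt ℝ (fun ω => scaledBracket ρ ω X Y i) ω := by
  simp only [scaledBracket, Matrix.mulVec, dotProduct]
  exact Finset.analyticAt_fun_sum _ fun q _ => (analyticAt_adjugate_gram ρ i q ω).mul
    (analyticAt_linear (evalForm ![X, Y, Pi.single q 1]) analyticAt_id)

theorem analyticAt_scaledBracket_scaledBracket (ρ : ⋀[ℝ]^8 V) (X Y Z : V) (i : Fin 8)
    (ω : Form 3) :
    AnalyticAt ℝ (fun ω => scaledBracket ρ ω X (scaledBracket ρ ω Y Z) i) ω := by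
  have h : (fun ω => scaledBracket ρ ω X (scaledBracket ρ ω Y Z) i) =
      fun ω => ∑ k, scaledBracket ρ ω Y Z k * scaledBracket ρ ω X (Pi.single k 1) i := by
    ext ω
    rw [scaledBracket_eq_sum, Finset.sum_apply]
    rfl
  rw [h]
  exact Finset.analyticAt_fun_sum _ fun k _ =>
    (analyticAt_scaledBracket _ _ _ _ _).mul (analyticAt_scaledBracket _ _ _ _ _)

/-- If `⟨u, ·⟩ = ω (X, Y, ·)` then `u` is proportional to the scaled bracket. -/
theorem scaledBracket_eq {ρ : ⋀[ℝ]^8 V} {ω : Form 3} {X Y u : V}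
    (hu : ∀ Z, reducedTraceForm ω ρ u Z = ω ![X, Y, Z]) :
    scaledBracket ρ ω X Y = (gram ω ρ).det • u := by
  have h : (fun q => ω ![X, Y, Pi.single q 1]) = (gram ω ρ).mulVec u := by
    ext q
    rw [← hu, reducedTraceForm_comm]
    have h : u = ∑ i, u i • (Pi.single i 1 : V) := by
      ext k; simp [Finset.sum_apply, Pi.single_apply]
    conv_lhs => rw [h]
    rw [map_sum]
    simp only [map_smul, smul_eq_mul, Matrix.mulVec, dotProduct, gram_apply, mul_comm]
  rw [scaledBracket, h, Matrix.mulVec_mulVec, Matrix.adjugate_mul, Matrix.smul_mulVec,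
    Matrix.one_mulVec]

/-- The bilinear map `[·, ·]` with `⟨[X, Y], Z⟩ = ω (X, Y, Z)`. -/
noncomputable def bracketOf (ω : Form 3) (ρ : ⋀[ℝ]^8 V)
    (h : (reducedTraceForm ω ρ).Nondegenerate) : V →ₗ[ℝ] V →ₗ[ℝ] V :=
  (trilinear ω).compr₂ ((reducedTraceForm ω ρ).toDual h).symm.toLinearMap

theorem reducedTraceForm_bracketOf (ω : Form 3) (ρ : ⋀[ℝ]^8 V)
    (h : (reducedTraceForm ω ρ).Nondegenerate) (X Y Z : V) :
    reducedTraceForm ω ρ (bracketOf ω ρ h X Y) Z = ω ![X, Y, Z] := by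
  rw [bracketOf, LinearMap.compr₂_apply, LinearEquiv.coe_coe,
    LinearMap.BilinForm.apply_toDual_symm_apply, trilinear_apply]

theorem eq_of_nondegenerate {ω : Form 3} {ρ : ⋀[ℝ]^8 V}
    (h : (reducedTraceForm ω ρ).Nondegenerate) {u v : V}
    (huv : ∀ Z, reducedTraceForm ω ρ u Z = reducedTraceForm ω ρ v Z) : u = v := by
  rw [← sub_eq_zero]
  refine h.1 _ fun Z => ?_
  rw [map_sub, LinearMap.sub_apply, huv, sub_self]

theorem IsBracketOf.unique {ω : Form 3} {ρ : ⋀[ℝ]^8 V}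
    (h : (reducedTraceForm ω ρ).Nondegenerate) {L L' : LieStructure V} (hL : IsBracketOf ω ρ L)
    (hL' : IsBracketOf ω ρ L') : L = L' := by
  refine LieStructure.ext (LinearMap.ext fun X => LinearMap.ext fun Y => ?_)
  exact eq_of_nondegenerate h fun Z => by rw [hL, hL']

/-- The left-hand side of the Jacobi identity for the scaled bracket. -/
noncomputable def scaledJacobi (ρ : ⋀[ℝ]^8 V) (X Y Z : V) (ω : Form 3) : V :=
  scaledBracket ρ ω X (scaledBracket ρ ω Y Z) + scaledBracket ρ ω Y (scaledBracket ρ ω Z X) +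
    scaledBracket ρ ω Z (scaledBracket ρ ω X Y)

theorem IsBracketOf.scaledJacobi_eq_zero {ω : Form 3} {ρ : ⋀[ℝ]^8 V} {L : LieStructure V}
    (hL : IsBracketOf ω ρ L) (X Y Z : V) : scaledJacobi ρ X Y Z ω = 0 := by
  simp only [scaledJacobi, scaledBracket_eq (hL _ _), map_smul]
  rw [← smul_add, ← smul_add, ← smul_add, ← smul_add, L.jacobi, smul_zero, smul_zero]

/-- The scaled Jacobi expression is the true one times the square of the Gram determinant, which can
be cancelled here. -/
theorem exists_isBracketOf_of_scaledJacobi {ω : Form 3} {ρ : ⋀[ℝ]^8 V}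
    (h : (reducedTraceForm ω ρ).Nondegenerate) (hJ : ∀ X Y Z, scaledJacobi ρ X Y Z ω = 0) :
    ∃ L : LieStructure V, IsBracketOf ω ρ L := by
  refine ⟨⟨bracketOf ω ρ h, fun X => ?_, fun X Y Z => ?_⟩, reducedTraceForm_bracketOf ω ρ h⟩
  · refine eq_of_nondegenerate h fun Z => ?_
    rw [reducedTraceForm_bracketOf, form_self, map_zero, LinearMap.zero_apply]
  · have hJ := hJ X Y Z
    simp only [scaledJacobi, scaledBracket_eq (reducedTraceForm_bracketOf ω ρ h _ _),
      map_smul] at hJ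
    rw [← smul_add, ← smul_add, ← smul_add, ← smul_add, smul_smul] at hJ
    have hd := (nondegenerate_iff_det_gram ω ρ).mp h
    exact (smul_eq_zero.mp hJ).resolve_left (mul_ne_zero hd hd)

/-- Transport of the bracket along a change of coordinates. -/
theorem IsBracketOf.compLinearMap {ω : Form 3} {ρ : ⋀[ℝ]^8 V} {L : LieStructure V}
    (hL : IsBracketOf ω ρ L) (g : V ≃ₗ[ℝ] V) :
    ∃ L' : LieStructure V, IsBracketOf (ω.compLinearMap g.toLinearMap) ρ L' := by
  -- Pull-back multiplies the trace form by `det g ^ 2`, so the transported bracket has to be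
  -- divided by it.
  set c : ℝ := (LinearMap.det g.toLinearMap ^ 2)⁻¹ with hc
  have hd : LinearMap.det g.toLinearMap ≠ 0 := g.isUnit_det'.ne_zero
  refine ⟨⟨c • (L.bracket.compl₁₂ g.toLinearMap g.toLinearMap).compr₂ g.symm.toLinearMap,
    fun X => ?_, fun X Y Z => ?_⟩, fun X Y Z => ?_⟩
  · simp [L.bracket_self]
  · have := L.jacobi (g X) (g Y) (g Z)
    simp only [LinearMap.smul_apply, LinearMap.compr₂_apply, LinearMap.compl₁₂_apply,
      LinearEquiv.coe_coe, map_smul, g.apply_symm_apply]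
    rw [← smul_add, ← smul_add, ← smul_add, ← smul_add, ← map_add, ← map_add, this, map_zero,
      smul_zero, smul_zero]
  · simp only [LinearMap.smul_apply, LinearMap.compr₂_apply, LinearMap.compl₁₂_apply,
      LinearEquiv.coe_coe, map_smul]
    rw [reducedTraceForm_compLinearMap, g.apply_symm_apply, hL, smul_eq_mul, hc,
      inv_mul_cancel_left₀ (pow_ne_zero 2 hd), AlternatingMap.compLinearMap_apply]
    congr 1
    ext i : 1
    fin_cases i <;> rfl

/-- If some stable 3-form defines a Lie algebra structure, then all stable forms do. -/
theorem IsStable.existsUnique_isBracketOf {φ ω : Form 3} (hφ : IsStable φ) (hω : IsStable ω)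
    {ρ : ⋀[ℝ]^8 V} (hnd : (reducedTraceForm ω ρ).Nondegenerate) {L : LieStructure V}
    (hL : IsBracketOf ω ρ L) :
    (reducedTraceForm φ ρ).Nondegenerate ∧ ∃! L : LieStructure V, IsBracketOf φ ρ L := by
  have h := hφ.nondegenerate hnd
  have hJ : ∀ X Y Z, scaledJacobi ρ X Y Z φ = 0 := by
    intro X Y Z
    ext i
    -- Near `ω` every form lies in the orbit of `ω` and inherits a Lie bracket; analyticity then
    -- carries the vanishing to `φ`.
    have h0 : (fun ω => scaledJacobi ρ X Y Z ω i) =ᶠ[𝓝 ω] fun _ => 0 := by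
      filter_upwards [((isStable_iff ω).mp hω).mem_nhds ⟨LinearEquiv.refl ℝ V, by ext; rfl⟩]
        with ψ hψ
      obtain ⟨g, rfl⟩ := hψ
      obtain ⟨L', hL'⟩ := hL.compLinearMap g
      rw [hL'.scaledJacobi_eq_zero]
      rfl
    exact congrFun (AnalyticOnNhd.eq_of_eventuallyEq (fun ω _ =>
      ((analyticAt_scaledBracket_scaledBracket ρ X Y Z i ω).add
        (analyticAt_scaledBracket_scaledBracket ρ Y Z X i ω)).add
        (analyticAt_scaledBracket_scaledBracket ρ Z X Y i ω))
      (fun _ _ => analyticAt_const) h0) φ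
  obtain ⟨L', hL'⟩ := exists_isBracketOf_of_scaledJacobi h hJ
  exact ⟨h, L', hL', fun L'' hL'' => hL''.unique h hL'⟩

/-! ### The orbit map -/

/-- Pull-back of forms, as a linear map. -/
noncomputable def pullback (k : ℕ) (g : V →ₗ[ℝ] V) : Form k →ₗ[ℝ] Form k where
  toFun ω := ω.compLinearMap g
  map_add' _ _ := rfl
  map_smul' _ _ := rfl

theorem pullback_apply {k : ℕ} (g : V →ₗ[ℝ] V) (ω : Form k) :
    pullback k g ω = ω.compLinearMap g := rfl

/-- The orbit map `A ↦ A^* φ`, on all endomorphisms. -/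
noncomputable def orbitMap (φ : Form 3) (A : V →L[ℝ] V) : Form 3 :=
  φ.compLinearMap (A : V →ₗ[ℝ] V)

theorem orbitMap_apply (φ : Form 3) (A : V →L[ℝ] V) (x y z : V) :
    orbitMap φ A ![x, y, z] = trilinear φ (A x) (A y) (A z) := by
  rw [orbitMap, AlternatingMap.compLinearMap_apply, trilinear_apply]
  congr 1
  ext i : 1
  fin_cases i <;> rfl

theorem orbitMap_one (φ : Form 3) : orbitMap φ 1 = φ := by
  ext; rfl

theorem trilinear_eq_sum (φ : Form 3) (x y z : V) :
    trilinear φ x y z = ∑ k, ∑ j, ∑ i, z k * (y j * (x i *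
      trilinear φ (Pi.single i 1) (Pi.single j 1) (Pi.single k 1))) := by
  have h : ∀ x : V, x = ∑ i, x i • (Pi.single i 1 : V) := fun x => by
    ext k; simp [Finset.sum_apply, Pi.single_apply]
  conv_lhs => rw [h x, h y, h z]
  simp only [map_sum, map_smul, LinearMap.sum_apply, LinearMap.smul_apply, smul_eq_mul,
    Finset.mul_sum]

theorem analyticAt_of_coeffs {E : Type*} [NormedAddCommGroup E] [NormedSpace ℝ E] {k : ℕ}
    {F : E → Form k} {x : E} (h : ∀ s, AnalyticAt ℝ (fun x => coeffs k (F x) s) x) :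
    AnalyticAt ℝ F x := by
  obtain ⟨r, hr⟩ := (coeffs k).exists_leftInverse_of_injective
    (LinearMap.ker_eq_bot.mpr (coeffs_injective k))
  have h1 : F = fun x => r (coeffs k (F x)) := by
    ext1 x
    exact (LinearMap.congr_fun hr (F x)).symm
  rw [h1]
  exact (ContinuousLinearMap.analyticAt (LinearMap.toContinuousLinearMap r) _).comp
    (AnalyticAt.pi h)

/-- Each coefficient of `A^* φ` is a cubic polynomial in the matrix entries of `A`. -/
theorem analyticAt_orbitMap (φ : Form 3) (A : V →L[ℝ] V) : AnalyticAt ℝ (orbitMap φ) A := by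
  refine analyticAt_of_coeffs fun s => ?_
  have hentry : ∀ a i, AnalyticAt ℝ (fun A : V →L[ℝ] V => A (Pi.single a 1) i) A := fun a i =>
    ((ContinuousLinearMap.proj (R := ℝ) (φ := fun _ : Fin 8 => ℝ) i).comp
      (ContinuousLinearMap.apply ℝ V (Pi.single a 1 : V))).analyticAt A
  have : (fun A => coeffs 3 (orbitMap φ A) s) = fun A : V →L[ℝ] V => ∑ k, ∑ j, ∑ i,
      A (Pi.single (s 2) 1) k * (A (Pi.single (s 1) 1) j * (A (Pi.single (s 0) 1) i *
        trilinear φ (Pi.single i 1) (Pi.single j 1) (Pi.single k 1))) := by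
    ext A
    rw [← trilinear_eq_sum, ← orbitMap_apply]
    change orbitMap φ A _ = _
    congr 1
    ext i : 1
    fin_cases i <;> rfl
  rw [this]
  exact Finset.analyticAt_fun_sum _ fun i _ => Finset.analyticAt_fun_sum _ fun j _ =>
    Finset.analyticAt_fun_sum _ fun k _ => (hentry _ _).mul ((hentry _ _).mul
      ((hentry _ _).mul analyticAt_const))

/-- The derivative of the orbit map at the identity. -/
noncomputable def infAction (φ : Form 3) : (V →L[ℝ] V) →L[ℝ] Form 3 := fderiv ℝ (orbitMap φ) 1

theorem hasStrictFDerivAt_orbitMap (φ : Form 3) :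
    HasStrictFDerivAt (orbitMap φ) (infAction φ) 1 :=
  (analyticAt_orbitMap φ 1).hasStrictFDerivAt

/-- A surjective derivative at the identity makes the orbit a neighbourhood of `φ`, and homogeneity
carries this to the other points of the orbit. -/
theorem isStable_of_surjective {φ : Form 3} (h : (infAction φ).range = ⊤) : IsStable φ := by
  rw [isStable_iff, isOpen_iff_mem_nhds]
  set O := {ψ : Form 3 | ∃ g : V ≃ₗ[ℝ] V, ψ = φ.compLinearMap g.toLinearMap} with hO
  have h1 : O ∈ 𝓝 φ := by
    have := (hasStrictFDerivAt_orbitMap φ).map_nhds_eq_of_surj h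
    rw [orbitMap_one] at this
    rw [← this, Filter.mem_map]
    -- The orbit map is defined on all endomorphisms, but those near the identity are invertible.
    filter_upwards [Units.isOpen.mem_nhds (isUnit_one : IsUnit (1 : V →L[ℝ] V))] with A hA
    obtain ⟨u, rfl⟩ := hA
    exact ⟨(ContinuousLinearEquiv.ofUnit u).toLinearEquiv, rfl⟩
  rintro ψ ⟨g, rfl⟩
  have hc : Continuous (pullback 3 g.symm.toLinearMap) :=
    LinearMap.continuous_of_finiteDimensional _
  have h2 : pullback 3 g.symm.toLinearMap (φ.compLinearMap g.toLinearMap) = φ := by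
    ext v
    simp [pullback_apply]
  have h3 := hc.continuousAt.preimage_mem_nhds (x := φ.compLinearMap g.toLinearMap)
    (t := O) (by rwa [h2])
  filter_upwards [h3] with η hη
  obtain ⟨g', hg'⟩ := hη
  refine ⟨g.trans g', ?_⟩
  have : η = pullback 3 g.toLinearMap (pullback 3 g.symm.toLinearMap η) := by
    ext v
    simp [pullback_apply]
  rw [this, hg']
  rfl

theorem hasDerivAt_orbitMap (φ : Form 3) (A : V →L[ℝ] V) :
    HasDerivAt (fun t : ℝ => orbitMap φ (1 + t • A)) (infAction φ A) 0 := by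
  have h : HasDerivAt (fun t : ℝ => (1 : V →L[ℝ] V) + t • A) A 0 := by
    simpa using ((hasDerivAt_id (0 : ℝ)).smul_const A).const_add 1
  have h0 : (1 : V →L[ℝ] V) = 1 + (0 : ℝ) • A := by simp
  have := (hasStrictFDerivAt_orbitMap φ).hasFDerivAt
  rw [h0] at this
  exact this.comp_hasDerivAt (0 : ℝ) h

/-- The derivative is the coefficient of `t` in the cubic polynomial `φ ((1 + tA) x, (1 + tA) y, (1
+ tA) z)`. -/
theorem infAction_apply (φ : Form 3) (A : V →L[ℝ] V) (x y z : V) :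
    infAction φ A ![x, y, z] =
      φ ![A x, y, z] + φ ![x, A y, z] + φ ![x, y, A z] := by
  have h1 : HasDerivAt (fun t : ℝ => orbitMap φ (1 + t • A) ![x, y, z])
      (infAction φ A ![x, y, z]) 0 :=
    (LinearMap.toContinuousLinearMap (evalForm ![x, y, z])).hasFDerivAt.comp_hasDerivAt (0 : ℝ)
      (hasDerivAt_orbitMap φ A)
  have h2 : HasDerivAt (fun t : ℝ => orbitMap φ (1 + t • A) ![x, y, z])
      (φ ![A x, y, z] + φ ![x, A y, z] + φ ![x, y, A z]) 0 := by
    simp only [orbitMap_apply]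
    simp only [← trilinear_apply]
    have : (fun t : ℝ => trilinear φ ((1 + t • A) x) ((1 + t • A) y) ((1 + t • A) z)) =
        fun t : ℝ => trilinear φ x y z + t * (trilinear φ (A x) y z + trilinear φ x (A y) z +
          trilinear φ x y (A z)) + t ^ 2 * (trilinear φ (A x) (A y) z +
          trilinear φ x (A y) (A z) + trilinear φ (A x) y (A z)) +
          t ^ 3 * trilinear φ (A x) (A y) (A z) := by
      ext t
      simp only [add_apply, one_apply_eq_self, smul_apply, map_add, map_smul, LinearMap.add_apply,
        LinearMap.smul_apply, smul_eq_mul]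
      ring
    rw [this]
    have h := ((((hasDerivAt_id (0 : ℝ)).mul_const (trilinear φ (A x) y z +
      trilinear φ x (A y) z + trilinear φ x y (A z))).const_add (trilinear φ x y z)).add
      ((hasDerivAt_pow 2 (0 : ℝ)).mul_const (trilinear φ (A x) (A y) z +
          trilinear φ x (A y) (A z) + trilinear φ (A x) y (A z)))).add
      ((hasDerivAt_pow 3 (0 : ℝ)).mul_const (trilinear φ (A x) (A y) (A z)))
    refine h.congr_deriv ?_
    simp
  exact h1.unique h2

/-! ### Infinitesimal equivariance -/

theorem hasDerivAt_det_one_add (A : V →ₗ[ℝ] V) :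
    HasDerivAt (fun t : ℝ => LinearMap.det (1 + t • A)) (LinearMap.trace ℝ V A) 0 := by
  set M := LinearMap.toMatrix (Pi.basisFun ℝ (Fin 8)) (Pi.basisFun ℝ (Fin 8)) A with hM
  set P := (Matrix.det (1 + (Polynomial.X : Polynomial ℝ) • M.map Polynomial.C)).divX.divX
  have : (fun t : ℝ => LinearMap.det (1 + t • A)) =
      fun t : ℝ => 1 + M.trace * t + P.eval t * t ^ 2 := by
    ext t
    rw [← LinearMap.det_toMatrix (Pi.basisFun ℝ (Fin 8)), map_add, map_smul,
      LinearMap.toMatrix_one, ← hM, Matrix.det_one_add_smul]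
  rw [this, LinearMap.trace_eq_matrix_trace ℝ (Pi.basisFun ℝ (Fin 8)), ← hM]
  have h := (((hasDerivAt_id (0 : ℝ)).const_mul M.trace).const_add 1).add
    ((P.hasDerivAt 0).mul (hasDerivAt_pow 2 (0 : ℝ)))
  exact h.congr_deriv (by simp)

theorem hasDerivAt_zero_comp {F : Form 3 → ℝ} {c : ℝ → Form 3} {t : ℝ}
    (hF : AnalyticAt ℝ F (c t)) (hc : HasDerivAt c 0 t) : HasDerivAt (fun t => F (c t)) 0 t := by
  have := hF.differentiableAt.hasFDerivAt.comp_hasDerivAt t hc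
  rwa [map_zero] at this

/-- The infinitesimal version of the equivariance of the reduced multiplication. -/
theorem map_reducedMul_of_infAction_eq_zero {φ : Form 3} {A : V →L[ℝ] V} (hA : infAction φ A = 0)
    (ρ : ⋀[ℝ]^8 V) (v w : V) :
    A (reducedMul φ ρ v w) = LinearMap.trace ℝ V (A : V →ₗ[ℝ] V) • reducedMul φ ρ v w +
      (reducedMul φ ρ (A v) w + reducedMul φ ρ v (A w)) := by
  have hc := hasDerivAt_orbitMap φ A
  rw [hA] at hc
  have h00 : orbitMap φ (1 + (0 : ℝ) • A) = φ := by rw [zero_smul, add_zero, orbitMap_one]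
  -- The curve `t ↦ (1 + tA)^* φ` has zero velocity at `0`, hence so does its reduced
  -- multiplication.
  have hs : HasDerivAt (fun t : ℝ => reducedMul (orbitMap φ (1 + t • A)) ρ v w) 0 0 := by
    rw [hasDerivAt_pi]
    intro i
    exact hasDerivAt_zero_comp (F := fun ω => reducedMul ω ρ v w i)
      (analyticAt_reducedMul ρ v w i _) hc
  have h1 : HasDerivAt (fun t : ℝ => reducedMul (orbitMap φ (1 + t • A)) ρ v w +
      t • A (reducedMul (orbitMap φ (1 + t • A)) ρ v w)) (A (reducedMul φ ρ v w)) 0 := by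
    have h := hs.add ((hasDerivAt_id (0 : ℝ)).smul (A.hasFDerivAt.comp_hasDerivAt (0 : ℝ) hs))
    refine h.congr_deriv ?_
    simp [orbitMap_one]
  have h2 : HasDerivAt (fun t : ℝ => LinearMap.det (1 + t • (A : V →ₗ[ℝ] V)) •
      (reducedMul φ ρ v w + t • (reducedMul φ ρ (A v) w + reducedMul φ ρ v (A w)) +
        t ^ 2 • reducedMul φ ρ (A v) (A w)))
      (LinearMap.trace ℝ V (A : V →ₗ[ℝ] V) • reducedMul φ ρ v w +
      (reducedMul φ ρ (A v) w + reducedMul φ ρ v (A w))) 0 := by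
    have h := (hasDerivAt_det_one_add (A : V →ₗ[ℝ] V)).smul
      ((((hasDerivAt_id (0 : ℝ)).smul_const
        (reducedMul φ ρ (A v) w + reducedMul φ ρ v (A w))).const_add (reducedMul φ ρ v w)).add
        ((hasDerivAt_pow 2 (0 : ℝ)).smul_const (reducedMul φ ρ (A v) (A w))))
    refine h.congr_deriv ?_
    simp [add_comm]
  -- Both curves agree by equivariance for `1 + tA`, which holds for every `t`, invertible or not;
  -- their derivatives at `0` give the claim.
  refine h1.unique ?_
  refine h2.congr_of_eventuallyEq (Filter.Eventually.of_forall fun t => ?_)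
  have h := map_reducedMul_compLinearMap φ ρ (1 + t • (A : V →ₗ[ℝ] V)) v w
  have hc : orbitMap φ (1 + t • A) = φ.compLinearMap (1 + t • (A : V →ₗ[ℝ] V)) := rfl
  simp only [hc]
  simp only [LinearMap.add_apply, Module.End.one_apply, LinearMap.smul_apply,
    ContinuousLinearMap.coe_coe] at h
  rw [h]
  congr 1
  simp only [map_add, map_smul, LinearMap.add_apply, LinearMap.smul_apply, smul_add, smul_smul]
  rw [sq]
  abel

/-- With `τ = tr A`, infinitesimal equivariance reads `L_{Av} = [A, L_v] - τ L_v`. In the trace the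
commutators cancel, and each of the two terms leaves `-τ`. -/
theorem reducedTraceForm_of_infAction_eq_zero {φ : Form 3} {A : V →L[ℝ] V}
    (hA : infAction φ A = 0) (ρ : ⋀[ℝ]^8 V) (v w : V) :
    reducedTraceForm φ ρ (A v) w + reducedTraceForm φ ρ v (A w) =
      -2 * LinearMap.trace ℝ V (A : V →ₗ[ℝ] V) * reducedTraceForm φ ρ v w := by
  set a : Module.End ℝ V := (A : V →ₗ[ℝ] V) with ha
  set τ := LinearMap.trace ℝ V a
  have h : ∀ v, reducedMul φ ρ (A v) =
      (a * reducedMul φ ρ v - reducedMul φ ρ v * a - τ • reducedMul φ ρ v : Module.End ℝ V) := by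
    intro v
    refine LinearMap.ext fun w => ?_
    have := map_reducedMul_of_infAction_eq_zero hA ρ v w
    simp only [LinearMap.sub_apply, Module.End.mul_apply, LinearMap.smul_apply, ha,
      ContinuousLinearMap.coe_coe, this]
    abel
  simp only [reducedTraceForm_apply, ← Module.End.mul_eq_comp, h]
  set l : Module.End ℝ V := reducedMul φ ρ v
  set m : Module.End ℝ V := reducedMul φ ρ w
  have h1 : LinearMap.trace ℝ V (a * (l * m)) = LinearMap.trace ℝ V (l * m * a) :=
    LinearMap.trace_mul_comm _ _ _
  simp only [sub_mul, mul_sub, map_sub, smul_mul_assoc, mul_smul_comm, map_smul, smul_eq_mul,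
    mul_assoc] at h1 ⊢
  linarith

theorem trace_eq_zero_of_infAction_eq_zero {φ : Form 3} {A : V →L[ℝ] V}
    (hA : infAction φ A = 0) {ρ : ⋀[ℝ]^8 V} (hnd : (reducedTraceForm φ ρ).Nondegenerate) :
    LinearMap.trace ℝ V (A : V →ₗ[ℝ] V) = 0 := by
  set τ := LinearMap.trace ℝ V (A : V →ₗ[ℝ] V) with hτ
  set M := LinearMap.toMatrix' (A : V →ₗ[ℝ] V) with hM
  have hd := (nondegenerate_iff_det_gram φ ρ).mp hnd
  set β := gram φ ρ with hβ
  have h : M.transpose * β + β * M = (-2 * τ) • β := by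
    have h1 : β * M = LinearMap.BilinForm.toMatrix'
        ((reducedTraceForm φ ρ).compRight (A : V →ₗ[ℝ] V)) := by
      rw [LinearMap.BilinForm.toMatrix'_compRight]; rfl
    have h2 : M.transpose * β = LinearMap.BilinForm.toMatrix'
        ((reducedTraceForm φ ρ).compLeft (A : V →ₗ[ℝ] V)) := by
      rw [LinearMap.BilinForm.toMatrix'_compLeft]; rfl
    rw [h1, h2, hβ, gram, ← map_add, ← map_smul]
    congr 1
    refine LinearMap.ext fun v => LinearMap.ext fun w => ?_
    have := reducedTraceForm_of_infAction_eq_zero hA ρ v w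
    rw [LinearMap.add_apply, LinearMap.add_apply, LinearMap.smul_apply, LinearMap.smul_apply,
      LinearMap.BilinForm.compLeft_apply, LinearMap.BilinForm.compRight_apply, smul_eq_mul,
      ContinuousLinearMap.coe_coe, this]
  have ht : M.trace = τ := by
    rw [hτ, LinearMap.trace_eq_matrix_trace ℝ (Pi.basisFun ℝ (Fin 8)), hM]; rfl
  have h1 : β⁻¹ * β = 1 := Matrix.nonsing_inv_mul _ (isUnit_iff_ne_zero.mpr hd)
  have h2 : β * β⁻¹ = 1 := Matrix.mul_nonsing_inv _ (isUnit_iff_ne_zero.mpr hd)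
  -- Contraction with the inverse Gram matrix gives `2 τ = -2 τ * 8`, so `τ = 0`.
  have h3 := congrArg (fun X => Matrix.trace (X * β⁻¹)) h
  simp only [add_mul, Matrix.trace_add, Matrix.smul_mul, mul_assoc, h2, mul_one,
    Matrix.trace_smul, Matrix.trace_transpose, Matrix.trace_one, smul_eq_mul, ht,
    Fintype.card_fin] at h3
  rw [Matrix.trace_mul_comm, mul_assoc, h1, mul_one, ht] at h3
  push_cast at h3
  linarith

/-! ### Stability by a dimension count -/

theorem finrank_form (k : ℕ) : Module.finrank ℝ (Form k) = Nat.choose 8 k := by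
  rw [(exteriorPower.alternatingMapLinearEquiv (R := ℝ) (M := V) (N := ℝ) (n := k)).finrank_eq]
  rw [show Module.finrank ℝ (↥(⋀[ℝ]^k V) →ₗ[ℝ] ℝ) = _ from Subspace.dual_finrank_eq,
    exteriorPower.finrank_eq]
  simp

/-- The infinitesimal stabilizer of `φ` consists of derivations of `𝔤`, all inner, so its dimension
is at most 8 and the infinitesimal orbit has dimension at least `64 - 8 = 56`. -/
theorem isStable_of_cartanForm {𝔤 : Type} [LieRing 𝔤] [LieAlgebra ℝ 𝔤] [LieAlgebra.IsKilling ℝ 𝔤]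
    {φ : Form 3} {f : V ≃ₗ[ℝ] 𝔤} {κ b : ℝ} {ρ : ⋀[ℝ]^8 V} (hκ : κ ≠ 0) (hb : b ≠ 0)
    (hφ : ∀ X Y Z, φ ![X, Y, Z] = κ * killingForm ℝ 𝔤 ⁅f X, f Y⁆ (f Z))
    (hB : ∀ X Y, reducedTraceForm φ ρ X Y = b * killingForm ℝ 𝔤 (f X) (f Y)) : IsStable φ := by
  have : Module.Finite ℝ 𝔤 := Module.Finite.equiv f
  have hnd : (reducedTraceForm φ ρ).Nondegenerate := by
    refine LinearMap.BilinForm.Nondegenerate.ofSeparatingLeft fun x hx => ?_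
    apply f.injective
    rw [map_zero]
    refine (LieAlgebra.IsKilling.killingForm_nondegenerate ℝ 𝔤).1 _ fun y => ?_
    have := hx (f.symm y)
    rw [hB, f.apply_symm_apply] at this
    exact (mul_eq_zero.mp this).resolve_left hb
  apply isStable_of_surjective
  -- the conjugates by `f` of the inner derivations
  let inner : 𝔤 →ₗ[ℝ] (V →L[ℝ] V) := LinearMap.toContinuousLinearMap.toLinearMap ∘ₗ
    f.symm.conj.toLinearMap ∘ₗ (LieAlgebra.ad ℝ 𝔤 : 𝔤 →ₗ[ℝ] Module.End ℝ 𝔤)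
  have hker : (infAction φ).ker ≤ inner.range := by
    intro A hA
    have hA : infAction φ A = 0 := hA
    have htr := trace_eq_zero_of_infAction_eq_zero hA hnd
    set D : 𝔤 →ₗ[ℝ] 𝔤 := f.conj (A : V →ₗ[ℝ] V) with hD
    have hDf : ∀ x, D (f x) = f (A x) := fun x => by
      rw [hD, LinearEquiv.conj_apply_apply, f.symm_apply_apply, ContinuousLinearMap.coe_coe]
    have hskew : ∀ x y, killingForm ℝ 𝔤 (D x) y = -killingForm ℝ 𝔤 x (D y) := by
      intro x y
      obtain ⟨x, rfl⟩ := f.surjective x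
      obtain ⟨y, rfl⟩ := f.surjective y
      have := reducedTraceForm_of_infAction_eq_zero hA ρ x y
      rw [htr, hB, hB, mul_zero, zero_mul, ← mul_add] at this
      rw [hDf, hDf]
      exact eq_neg_of_add_eq_zero_left ((mul_eq_zero.mp this).resolve_left hb)
    -- Invariance of `φ` is the derivation rule paired with `z`, once skewness moves `D` from `z` to
    -- the bracket.
    have hder : ∀ x y, D ⁅x, y⁆ = ⁅D x, y⁆ + ⁅x, D y⁆ := by
      intro x y
      obtain ⟨x, rfl⟩ := f.surjective x
      obtain ⟨y, rfl⟩ := f.surjective y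
      rw [← sub_eq_zero]
      refine (LieAlgebra.IsKilling.killingForm_nondegenerate ℝ 𝔤).1 _ fun z => ?_
      obtain ⟨z, rfl⟩ := f.surjective z
      have := infAction_apply φ A x y z
      rw [hA, hφ, hφ, hφ, ← mul_add, ← mul_add, ← hDf, ← hDf, ← hDf] at this
      have h0 := (mul_eq_zero.mp this.symm).resolve_left hκ
      rw [map_sub, LinearMap.sub_apply, hskew, map_add, LinearMap.add_apply]
      linarith
    obtain ⟨u, hu⟩ := LieDerivation.IsKilling.exists_eq_ad (R := ℝ) (L := 𝔤)
      ⟨D, fun x y => by rw [hder, ← lie_skew (D x) y]; abel⟩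
    refine ⟨u, ?_⟩
    ext1 x
    apply f.injective
    have h1 : ⁅u, f x⁆ = D (f x) := by
      have := congrArg (fun d : LieDerivation ℝ 𝔤 𝔤 => d (f x)) hu
      rwa [LieDerivation.ad_apply_apply] at this
    rw [← hDf, ← h1]
    exact f.apply_symm_apply _
  have h1 := LinearMap.finrank_range_add_finrank_ker (infAction φ : (V →L[ℝ] V) →ₗ[ℝ] Form 3)
  have h2 : Module.finrank ℝ (V →L[ℝ] V) = 64 := by
    rw [← (LinearMap.toContinuousLinearMap (𝕜 := ℝ) (E := V) (F' := V)).finrank_eq,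
      Module.finrank_linearMap]
    simp
  have h3 : Module.finrank ℝ (infAction φ).ker ≤ 8 :=
    (Submodule.finrank_mono hker).trans ((LinearMap.finrank_range_le inner).trans
      (by rw [← f.finrank_eq]; simp))
  have h4 : Module.finrank ℝ (Form 3) = 56 := by rw [finrank_form]; rfl
  apply Submodule.eq_top_of_finrank_eq
  have h5 := Submodule.finrank_le (infAction φ).range
  have h6 : Module.finrank ℝ (infAction φ).range + Module.finrank ℝ (infAction φ).ker =
    Module.finrank ℝ (V →L[ℝ] V) := h1
  omega

/-! ### Real forms of `sl(3, ℂ)` -/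

section SpecialLinear

variable {K : Type*} [Field K] {n : Type*} [Fintype n] [DecidableEq n]

theorem mem_sl_iff (A : Matrix n n K) : A ∈ LieAlgebra.SpecialLinear.sl n K ↔ A.trace = 0 :=
  Iff.rfl

theorem trace_mulLeft_comp_mulRight (A B : Matrix n n K) :
    LinearMap.trace K (Matrix n n K) (LinearMap.mulLeft K A ∘ₗ LinearMap.mulRight K B) =
      A.trace * B.trace := by
  rw [LinearMap.trace_eq_matrix_trace K (Matrix.stdBasis K n n), Matrix.trace]
  simp only [Matrix.diag_apply, LinearMap.toMatrix_apply, Fintype.sum_prod_type]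
  have hrepr : ∀ (X : Matrix n n K) i j, (Matrix.stdBasis K n n).repr X (i, j) = X i j :=
    fun _ _ _ => rfl
  simp [Matrix.stdBasis_eq_single, hrepr, Matrix.mul_apply, Matrix.trace, Finset.sum_mul_sum,
    Matrix.single_apply, ite_and]

/-- The operator `ad A ∘ ad B` extends to all matrices with image in the traceless ones, so its
trace can be computed there: `X ↦ P X Q` has trace `tr P * tr Q`, and the mixed terms vanish. -/
theorem killingForm_sl (A B : LieAlgebra.SpecialLinear.sl n K) :
    killingForm K _ A B = 2 * Fintype.card n * (A.val * B.val).trace := by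
  set p := (LieAlgebra.SpecialLinear.sl n K).toSubmodule
  let T : Module.End K (Matrix n n K) :=
    (LinearMap.mulLeft K A.val - LinearMap.mulRight K A.val) ∘ₗ
      (LinearMap.mulLeft K B.val - LinearMap.mulRight K B.val)
  have hT : ∀ X, T X ∈ p := fun X =>
    LieAlgebra.matrix_trace_commutator_zero n K A.val (B.val * X - X * B.val)
  have h1 := T.trace_restrict_eq_of_forall_mem p hT
  have h2 : killingForm K _ A B = LinearMap.trace K p (T.restrict fun x _ => hT x) := rfl
  have hA : A.val.trace = 0 := A.2
  have h3 : T = LinearMap.mulLeft K (A.val * B.val) ∘ₗ LinearMap.mulRight K 1 -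
      LinearMap.mulLeft K A.val ∘ₗ LinearMap.mulRight K B.val -
      LinearMap.mulLeft K B.val ∘ₗ LinearMap.mulRight K A.val +
      LinearMap.mulLeft K 1 ∘ₗ LinearMap.mulRight K (B.val * A.val) := by
    refine LinearMap.ext fun X => ?_
    simp only [T, LinearMap.comp_apply, LinearMap.sub_apply, LinearMap.add_apply,
      LinearMap.mulLeft_apply, LinearMap.mulRight_apply]
    noncomm_ring
  rw [h2, h1, h3, map_add, map_sub, map_sub]
  simp only [trace_mulLeft_comp_mulRight, hA, Matrix.trace_one]
  rw [Matrix.trace_mul_comm B.val]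
  ring

theorem finrank_sl [Nonempty n] : Module.finrank K (LieAlgebra.SpecialLinear.sl n K) + 1 =
    Fintype.card n * Fintype.card n := by
  have h := LinearMap.finrank_range_add_finrank_ker (Matrix.traceLinearMap n K K)
  have hs : Function.Surjective (Matrix.traceLinearMap n K K) := fun c =>
    ⟨Matrix.single (Classical.arbitrary n) (Classical.arbitrary n) c, by simp⟩
  rw [LinearMap.range_eq_top.mpr hs, finrank_top, Module.finrank_self,
    Module.finrank_matrix, Module.finrank_self, mul_one, add_comm] at h
  exact h

end SpecialLinear

theorem killingForm_baseChange_tmul {𝔤 : Type} [LieRing 𝔤] [LieAlgebra ℝ 𝔤] [Module.Finite ℝ 𝔤]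
    (x y : 𝔤) : killingForm ℂ (ℂ ⊗[ℝ] 𝔤) (1 ⊗ₜ x) (1 ⊗ₜ y) = (killingForm ℝ 𝔤 x y : ℂ) := by
  have h : ∀ x : 𝔤, LieAlgebra.ad ℂ (ℂ ⊗[ℝ] 𝔤) (1 ⊗ₜ x) = (LieAlgebra.ad ℝ 𝔤 x).baseChange ℂ := by
    intro x
    ext y
    simp
  rw [killingForm_apply_apply, h, h, ← LinearMap.baseChange_comp, LinearMap.trace_baseChange,
    killingForm_apply_apply]
  rfl

/-! ### Matrix models of real forms -/

/-- A faithful representation of a real Lie algebra by traceless complex `3 × 3` matrices that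
identifies its complexification with `sl(3, ℂ)`. -/
structure ComplexModel (𝔤 : Type) [LieRing 𝔤] [LieAlgebra ℝ 𝔤] where
  /-- The underlying map. -/
  toMatrix : 𝔤 →ₗ[ℝ] Matrix (Fin 3) (Fin 3) ℂ
  map_lie : ∀ x y, toMatrix ⁅x, y⁆ = toMatrix x * toMatrix y - toMatrix y * toMatrix x
  trace_eq_zero : ∀ x, (toMatrix x).trace = 0
  injective : Function.Injective toMatrix
  exists_eq : ∀ A : Matrix (Fin 3) (Fin 3) ℂ, A.trace = 0 →
    ∃ x y, A = toMatrix x + Complex.I • toMatrix y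
  finrank_eq : Module.finrank ℝ 𝔤 = 8

namespace ComplexModel

variable {𝔤 : Type} [LieRing 𝔤] [LieAlgebra ℝ 𝔤] (j : ComplexModel 𝔤)

theorem finite (j : ComplexModel 𝔤) : Module.Finite ℝ 𝔤 :=
  Module.finite_of_finrank_pos (by rw [j.finrank_eq]; norm_num)

/-- The complex-linear extension. -/
noncomputable def extend : ℂ ⊗[ℝ] 𝔤 →ₗ[ℂ] Matrix (Fin 3) (Fin 3) ℂ :=
  j.toMatrix.liftBaseChange ℂ

theorem extend_tmul (z : ℂ) (x : 𝔤) : j.extend (z ⊗ₜ x) = z • j.toMatrix x := by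
  simp [extend]

theorem extend_mem (u : ℂ ⊗[ℝ] 𝔤) : j.extend u ∈ sl3C := by
  induction u using TensorProduct.induction_on with
  | zero => rw [map_zero]; exact zero_mem _
  | tmul z x =>
    rw [extend_tmul, mem_sl_iff, Matrix.trace_smul, j.trace_eq_zero, smul_zero]
  | add u v hu hv => rw [map_add]; exact add_mem hu hv

theorem extend_lie (u v : ℂ ⊗[ℝ] 𝔤) :
    j.extend ⁅u, v⁆ = j.extend u * j.extend v - j.extend v * j.extend u := by
  induction u using TensorProduct.induction_on with
  | zero => simp
  | add u u' hu hu' => rw [add_lie, map_add, hu, hu', map_add]; noncomm_ring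
  | tmul z x =>
    induction v using TensorProduct.induction_on with
    | zero =>
      have h := LieRing.lie_add (z ⊗ₜ[ℝ] x) (0 : ℂ ⊗[ℝ] 𝔤) 0
      rw [add_zero, left_eq_add] at h
      rw [h, map_zero, mul_zero, zero_mul, sub_zero]
    | add v v' hv hv' => rw [LieRing.lie_add, map_add, hv, hv', map_add]; noncomm_ring
    | tmul w y =>
      rw [LieAlgebra.ExtendScalars.bracket_tmul, extend_tmul, extend_tmul, extend_tmul, j.map_lie,
        smul_mul_smul_comm, smul_mul_smul_comm, mul_comm w z, smul_sub]

/-- The complex-linear extension, as a homomorphism of Lie algebras. -/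
noncomputable def lieHom : (ℂ ⊗[ℝ] 𝔤) →ₗ⁅ℂ⁆ sl3C where
  toLinearMap := j.extend.codRestrict sl3C.toSubmodule j.extend_mem
  map_lie' {u v} := Subtype.ext (j.extend_lie u v)

theorem lieHom_bijective : Function.Bijective j.lieHom := by
  have := j.finite
  have hs : Function.Surjective j.lieHom := by
    rintro ⟨A, hA⟩
    obtain ⟨x, y, rfl⟩ := j.exists_eq A hA
    refine ⟨1 ⊗ₜ x + Complex.I ⊗ₜ y, Subtype.ext ?_⟩
    change j.extend _ = _
    rw [map_add, extend_tmul, extend_tmul, one_smul]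
  refine ⟨?_, hs⟩
  have h8 : Module.finrank ℂ (ℂ ⊗[ℝ] 𝔤) = Module.finrank ℂ sl3C := by
    have : Module.finrank ℂ sl3C + 1 = 9 := finrank_sl
    rw [Module.finrank_baseChange, j.finrank_eq]
    omega
  exact (LinearMap.injective_iff_surjective_of_finrank_eq_finrank h8
    (f := (j.lieHom : (ℂ ⊗[ℝ] 𝔤) →ₗ[ℂ] sl3C))).mpr hs

theorem isRealForm (j : ComplexModel 𝔤) : IsRealFormOfSl3C 𝔤 :=
  ⟨LieEquiv.ofBijective j.lieHom j.lieHom_bijective⟩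

/-- The Killing form is compatible with base change and with isomorphisms; `6` is `2 * 3` from
`sl(3, ℂ)`. -/
theorem killingForm_eq (x y : 𝔤) :
    (killingForm ℝ 𝔤 x y : ℂ) = 6 * (j.toMatrix x * j.toMatrix y).trace := by
  have := j.finite
  rw [← killingForm_baseChange_tmul, ← LieAlgebra.killingForm_of_equiv_apply
    (LieEquiv.ofBijective j.lieHom j.lieHom_bijective), killingForm_sl]
  change _ * (j.extend (1 ⊗ₜ x) * j.extend (1 ⊗ₜ y)).trace = _
  rw [extend_tmul, extend_tmul, one_smul, one_smul, Fintype.card_fin]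
  norm_num

open scoped ComplexOrder in
-- If `X` is orthogonal to `𝔤`, it is trace-orthogonal to the complex span of `𝔤`, which contains
-- the conjugate transpose of `X`; then `tr (X X^*) = 0` forces `X = 0`.
theorem isKilling (j : ComplexModel 𝔤) : LieAlgebra.IsKilling ℝ 𝔤 := by
  constructor
  rw [eq_bot_iff]
  intro x hx
  rw [LieIdeal.mem_killingCompl] at hx
  rw [LieSubmodule.mem_bot]
  apply j.injective
  rw [map_zero, ← Matrix.trace_mul_conjTranspose_self_eq_zero_iff]
  have htr : (j.toMatrix x).conjTranspose.trace = 0 := by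
    rw [Matrix.trace_conjTranspose, j.trace_eq_zero, star_zero]
  obtain ⟨u, v, huv⟩ := j.exists_eq _ htr
  have h : ∀ u, (j.toMatrix x * j.toMatrix u).trace = 0 := by
    intro u
    have h1 := j.killingForm_eq u x
    rw [hx u trivial, Complex.ofReal_zero, Matrix.trace_mul_comm] at h1
    exact (mul_eq_zero.mp h1.symm).resolve_left (by norm_num)
  rw [huv, mul_add, Matrix.trace_add, h, Matrix.mul_smul, Matrix.trace_smul, h, smul_zero,
    add_zero]

/-- Transport along an isomorphism. -/
noncomputable def comp {𝔥 : Type} [LieRing 𝔥] [LieAlgebra ℝ 𝔥] (h : 𝔥 ≃ₗ⁅ℝ⁆ 𝔤) :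
    ComplexModel 𝔥 where
  toMatrix := j.toMatrix ∘ₗ h.toLinearEquiv.toLinearMap
  map_lie x y := by
    have := j.map_lie (h x) (h y)
    rwa [← LieEquiv.map_lie] at this
  trace_eq_zero x := j.trace_eq_zero (h x)
  injective := j.injective.comp h.injective
  exists_eq A hA := by
    obtain ⟨x, y, hxy⟩ := j.exists_eq A hA
    obtain ⟨x, rfl⟩ := h.surjective x
    obtain ⟨y, rfl⟩ := h.surjective y
    exact ⟨x, y, hxy⟩
  finrank_eq := by rw [h.toLinearEquiv.finrank_eq, j.finrank_eq]

end ComplexModel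

/-- The inclusion of `sl(3, ℝ)` into `sl(3, ℂ)`. -/
noncomputable def sl3RModel : ComplexModel sl3R where
  toMatrix := (Complex.ofRealCLM : ℝ →ₗ[ℝ] ℂ).mapMatrix ∘ₗ sl3R.toSubmodule.subtype
  map_lie x y := by
    change (x.val * y.val - y.val * x.val).map Complex.ofRealHom =
      x.val.map Complex.ofRealHom * y.val.map Complex.ofRealHom -
        y.val.map Complex.ofRealHom * x.val.map Complex.ofRealHom
    rw [← Matrix.map_mul, ← Matrix.map_mul, Matrix.map_sub _ (map_sub _)]
  trace_eq_zero x := by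
    have h : x.val.trace = 0 := x.2
    change (x.val.map Complex.ofRealHom).trace = 0
    rw [← AddMonoidHom.map_trace, h, map_zero]
  injective x y h := by
    ext i k
    exact Complex.ofReal_injective (congrFun (congrFun h i) k)
  exists_eq A hA := by
    have h : A.trace = ∑ i, A i i := rfl
    rw [h] at hA
    refine ⟨⟨A.map Complex.re, ?_⟩, ⟨A.map Complex.im, ?_⟩, ?_⟩
    · have := congrArg Complex.re hA
      rw [Complex.re_sum] at this
      exact this
    · have := congrArg Complex.im hA
      rw [Complex.im_sum] at this
      exact this
    · ext i k
      change A i k = (A i k).re + Complex.I * (A i k).im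
      rw [mul_comm, Complex.re_add_im]
  finrank_eq := by
    have : Module.finrank ℝ sl3R + 1 = 9 := finrank_sl
    omega

theorem mem_su_iff {J A : Matrix (Fin 3) (Fin 3) ℂ} :
    A ∈ su J ↔ A.conjTranspose * J + J * A = 0 ∧ A.trace = 0 := Iff.rfl

/-- The inclusion of `su(J)` into `sl(3, ℂ)`, for a Hermitian involution `J`. -/
noncomputable def suModel (J : Matrix (Fin 3) (Fin 3) ℂ) (hJ : J.conjTranspose = J)
    (hJ2 : J * J = 1) (hfin : Module.finrank ℝ (su J) = 8) : ComplexModel (su J) where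
  toMatrix := (su J).toSubmodule.subtype
  map_lie x y := rfl
  trace_eq_zero x := x.2.2
  injective := Subtype.val_injective
  exists_eq A hA := by
    have htr : (J * A.conjTranspose * J).trace = 0 := by
      rw [Matrix.trace_mul_comm, ← mul_assoc, hJ2, one_mul, Matrix.trace_conjTranspose, hA,
        star_zero]
    -- Real and imaginary parts with respect to the antilinear involution `A ↦ -J A^* J`, whose
    -- fixed points among traceless matrices form `su(J)`.
    refine ⟨⟨(2⁻¹ : ℂ) • (A - J * A.conjTranspose * J), mem_su_iff.mpr ⟨?_, ?_⟩⟩,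
      ⟨(-(Complex.I * 2⁻¹)) • (A + J * A.conjTranspose * J), mem_su_iff.mpr ⟨?_, ?_⟩⟩, ?_⟩
    · have h1 : star (2⁻¹ : ℂ) = 2⁻¹ := by simp
      rw [Matrix.conjTranspose_smul, h1, Matrix.smul_mul, Matrix.mul_smul, ← smul_add,
        Matrix.conjTranspose_sub, Matrix.conjTranspose_mul, Matrix.conjTranspose_mul,
        Matrix.conjTranspose_conjTranspose, hJ]
      have : (A.conjTranspose - J * (A * J)) * J + J * (A - J * A.conjTranspose * J) =
        A.conjTranspose * J - J * A * (J * J) + J * A - (J * J) * A.conjTranspose * J := by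
        noncomm_ring
      rw [this, hJ2]
      simp
    · rw [Matrix.trace_smul, Matrix.trace_sub, hA, htr, sub_zero, smul_zero]
    · have h1 : star (-(Complex.I * 2⁻¹) : ℂ) = -(-(Complex.I * 2⁻¹)) := by simp
      rw [Matrix.conjTranspose_smul, h1, Matrix.smul_mul, Matrix.mul_smul, neg_smul,
        neg_add_eq_zero, Matrix.conjTranspose_add, Matrix.conjTranspose_mul,
        Matrix.conjTranspose_mul, Matrix.conjTranspose_conjTranspose, hJ]
      congr 1
      have h2 : (A.conjTranspose + J * (A * J)) * J = A.conjTranspose * J + J * A * (J * J) := by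
        noncomm_ring
      have h3 : J * (A + J * A.conjTranspose * J) = J * A + (J * J) * A.conjTranspose * J := by
        noncomm_ring
      rw [h2, h3, hJ2]
      simp [add_comm]
    · rw [Matrix.trace_smul, Matrix.trace_add, hA, htr, add_zero, smul_zero]
    · change A = (2⁻¹ : ℂ) • (A - J * A.conjTranspose * J) +
        Complex.I • ((-(Complex.I * 2⁻¹)) • (A + J * A.conjTranspose * J))
      rw [smul_smul, show Complex.I * -(Complex.I * 2⁻¹) = (2⁻¹ : ℂ) by
        rw [mul_neg, ← mul_assoc, Complex.I_mul_I]; simp, ← smul_add]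
      rw [sub_add_add_cancel, ← two_smul ℂ A, smul_smul]
      simp
  finrank_eq := hfin

/-! ### Forms that are Cartan forms up to a factor -/

theorem exists_cube_eq {κ : ℝ} : ∃ s : ℝ, s ^ 3 = κ := by
  rcases le_total 0 κ with h | h
  · exact ⟨κ ^ ((3 : ℕ)⁻¹ : ℝ), Real.rpow_inv_natCast_pow h (by norm_num)⟩
  · refine ⟨-(-κ) ^ ((3 : ℕ)⁻¹ : ℝ), ?_⟩
    rw [Odd.neg_pow (by decide), Real.rpow_inv_natCast_pow (neg_nonneg.mpr h) (by norm_num),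
      neg_neg]

/-- An identification of `ℝ⁸` with a Lie algebra under which `φ` is a multiple of the Cartan
3-form, and the reduced trace forms are multiples of the Killing form. -/
structure CartanModel (φ : Form 3) (𝔤 : Type) [LieRing 𝔤] [LieAlgebra ℝ 𝔤] where
  /-- The identification. -/
  equiv : V ≃ₗ[ℝ] 𝔤
  /-- The factor of the Cartan 3-form. -/
  formFactor : ℝ
  /-- The factor of the Killing form. -/
  traceFactor : ℝ
  formFactor_ne_zero : formFactor ≠ 0
  traceFactor_ne_zero : traceFactor ≠ 0
  form_eq : ∀ X Y Z, φ ![X, Y, Z] =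
    formFactor * killingForm ℝ 𝔤 ⁅equiv X, equiv Y⁆ (equiv Z)
  trace_eq : ∀ ρ X Y, reducedTraceForm φ ρ X Y =
    scale ρ ^ 2 * traceFactor * killingForm ℝ 𝔤 (equiv X) (equiv Y)

namespace CartanModel

variable {φ : Form 3} {𝔤 : Type} [LieRing 𝔤] [LieAlgebra ℝ 𝔤] (C : CartanModel φ 𝔤)

theorem factor_ne_zero {ρ : ⋀[ℝ]^8 V} (hρ : ρ ≠ 0) : scale ρ ^ 2 * C.traceFactor ≠ 0 :=
  mul_ne_zero (pow_ne_zero 2 (scale_ne_zero hρ)) C.traceFactor_ne_zero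

theorem isStable [LieAlgebra.IsKilling ℝ 𝔤] (C : CartanModel φ 𝔤) : IsStable φ := by
  have : Nontrivial (⋀[ℝ]^8 V) := by
    apply Module.nontrivial_of_finrank_pos (R := ℝ)
    rw [exteriorPower.finrank_eq]
    simp
  obtain ⟨ρ, hρ⟩ := exists_ne (0 : ⋀[ℝ]^8 V)
  exact isStable_of_cartanForm (ρ := ρ) C.formFactor_ne_zero (C.factor_ne_zero hρ) C.form_eq
    (C.trace_eq ρ)

include C in
theorem nondegenerate [LieAlgebra.IsKilling ℝ 𝔤] {ρ : ⋀[ℝ]^8 V} (hρ : ρ ≠ 0) :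
    (reducedTraceForm φ ρ).Nondegenerate := by
  have : Module.Finite ℝ 𝔤 := Module.Finite.equiv C.equiv
  refine LinearMap.BilinForm.Nondegenerate.ofSeparatingLeft fun x hx => ?_
  apply C.equiv.injective
  rw [map_zero]
  refine (LieAlgebra.IsKilling.killingForm_nondegenerate ℝ 𝔤).1 _ fun y => ?_
  have := hx (C.equiv.symm y)
  rw [C.trace_eq, C.equiv.apply_symm_apply] at this
  exact (mul_eq_zero.mp this).resolve_left (C.factor_ne_zero hρ)

/-- The Lie algebra structure on `ℝ⁸` that corresponds to the bracket of `𝔤`, up to a factor. -/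
noncomputable def lieStructure (c : ℝ) : LieStructure V where
  bracket := c • ((LieModule.toEnd ℝ 𝔤 𝔤 : 𝔤 →ₗ[ℝ] 𝔤 →ₗ[ℝ] 𝔤).compl₁₂ C.equiv.toLinearMap
    C.equiv.toLinearMap).compr₂ C.equiv.symm.toLinearMap
  bracket_self x := by simp
  jacobi x y z := by
    have h := lie_jacobi (C.equiv x) (C.equiv y) (C.equiv z)
    apply C.equiv.injective
    simp only [LinearMap.smul_apply, LinearMap.compr₂_apply, LinearMap.compl₁₂_apply,
      LinearEquiv.coe_coe, map_smul, map_add, C.equiv.apply_symm_apply, LieHom.coe_toLinearMap,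
      LieModule.toEnd_apply_apply, map_zero]
    rw [← smul_add, ← smul_add, ← smul_add, ← smul_add, h, smul_zero, smul_zero]

theorem equiv_lieStructure_bracket (c : ℝ) (x y : V) :
    C.equiv ((C.lieStructure c).bracket x y) = c • ⁅C.equiv x, C.equiv y⁆ := by
  simp only [lieStructure, LinearMap.smul_apply, LinearMap.compr₂_apply, LinearMap.compl₁₂_apply,
    LinearEquiv.coe_coe, map_smul, C.equiv.apply_symm_apply, LieHom.coe_toLinearMap,
    LieModule.toEnd_apply_apply]

/-- With trace form `b K` and 3-form `κ K([X, Y], Z)`, the bracket must be `b⁻¹ κ` times that of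
`𝔤`. -/
theorem isBracketOf {ρ : ⋀[ℝ]^8 V} (hρ : ρ ≠ 0) :
    IsBracketOf φ ρ (C.lieStructure ((scale ρ ^ 2 * C.traceFactor)⁻¹ * C.formFactor)) := by
  intro X Y Z
  rw [C.trace_eq, equiv_lieStructure_bracket, map_smul, LinearMap.smul_apply, smul_eq_mul,
    ← mul_assoc, mul_inv_cancel_left₀ (C.factor_ne_zero hρ), C.form_eq]

theorem equiv_bracket [LieAlgebra.IsKilling ℝ 𝔤] {ρ : ⋀[ℝ]^8 V} (hρ : ρ ≠ 0)
    {L : LieStructure V} (hL : IsBracketOf φ ρ L) (x y : V) :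
    C.equiv (L.bracket x y) =
      ((scale ρ ^ 2 * C.traceFactor)⁻¹ * C.formFactor) • ⁅C.equiv x, C.equiv y⁆ := by
  rw [hL.unique (C.nondegenerate hρ) (C.isBracketOf hρ), equiv_lieStructure_bracket]

/-- The isomorphism with the Lie algebra defined by `φ`. -/
noncomputable def lieEquiv [LieAlgebra.IsKilling ℝ 𝔤] {ρ : ⋀[ℝ]^8 V} (hρ : ρ ≠ 0)
    {L : LieStructure V} (hL : IsBracketOf φ ρ L) : L.Carrier ≃ₗ⁅ℝ⁆ 𝔤 where
  -- If the new bracket is `c [x, y]`, multiplication by `c` is a homomorphism, since `c (c [x, y])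
  -- = [c x, c y]`.
  __ := L.of.symm.trans (C.equiv.trans (LinearEquiv.smulOfNeZero ℝ 𝔤
    ((scale ρ ^ 2 * C.traceFactor)⁻¹ * C.formFactor)
    (mul_ne_zero (inv_ne_zero (C.factor_ne_zero hρ)) C.formFactor_ne_zero)))
  map_lie' {x y} := by
    obtain ⟨x, rfl⟩ := L.of.surjective x
    obtain ⟨y, rfl⟩ := L.of.surjective y
    let c : ℝ := (scale ρ ^ 2 * C.traceFactor)⁻¹ * C.formFactor
    change c • C.equiv (L.bracket x y) = ⁅c • C.equiv x, c • C.equiv y⁆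
    rw [C.equiv_bracket hρ hL, smul_lie, lie_smul]

theorem lieEquiv_of [LieAlgebra.IsKilling ℝ 𝔤] {ρ : ⋀[ℝ]^8 V} (hρ : ρ ≠ 0)
    {L : LieStructure V} (hL : IsBracketOf φ ρ L) (x : V) : C.lieEquiv hρ hL (L.of x) =
      ((scale ρ ^ 2 * C.traceFactor)⁻¹ * C.formFactor) • C.equiv x := rfl

include C in
theorem isMultipleOfCartanForm [LieAlgebra.IsKilling ℝ 𝔤] {ρ : ⋀[ℝ]^8 V} (hρ : ρ ≠ 0)
    {L : LieStructure V} (hL : IsBracketOf φ ρ L) : IsMultipleOfCartanForm φ L := by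
  set c := (scale ρ ^ 2 * C.traceFactor)⁻¹ * C.formFactor with hc
  have hc0 : c ≠ 0 := mul_ne_zero (inv_ne_zero (C.factor_ne_zero hρ)) C.formFactor_ne_zero
  -- The isomorphism scales each of the three arguments by `c`, so the Cartan 3-forms differ by `c ^
  -- 3`.
  refine ⟨C.formFactor * (c ^ 3)⁻¹,
    mul_ne_zero C.formFactor_ne_zero (inv_ne_zero (pow_ne_zero 3 hc0)), fun X Y Z => ?_⟩
  rw [cartanForm, ← LieAlgebra.killingForm_of_equiv_apply (C.lieEquiv hρ hL), LieEquiv.map_lie,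
    lieEquiv_of, lieEquiv_of, lieEquiv_of, ← hc, smul_lie, lie_smul, C.form_eq]
  simp only [map_smul, LinearMap.smul_apply, smul_eq_mul]
  field_simp

include C in
-- Rescaling the identification by a real cube root of the factor, of either sign, absorbs it.
theorem isEquivalentToCartanForm : IsEquivalentToCartanForm 𝔤 φ := by
  obtain ⟨s, hs⟩ := exists_cube_eq (κ := C.formFactor)
  have hs0 : s ≠ 0 := by
    rintro rfl
    exact C.formFactor_ne_zero (by rw [← hs]; norm_num)
  refine ⟨C.equiv.trans (LinearEquiv.smulOfNeZero ℝ 𝔤 s hs0), fun X Y Z => ?_⟩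
  change _ = cartanForm 𝔤 (s • C.equiv X) (s • C.equiv Y) (s • C.equiv Z)
  rw [cartanForm, smul_lie, lie_smul, C.form_eq, ← hs]
  simp only [map_smul, LinearMap.smul_apply, smul_eq_mul]
  ring

end CartanModel

theorem isCompactLie_congr {𝔤 𝔥 : Type} [LieRing 𝔤] [LieAlgebra ℝ 𝔤] [LieRing 𝔥]
    [LieAlgebra ℝ 𝔥] (h : 𝔤 ≃ₗ⁅ℝ⁆ 𝔥) : IsCompactLie 𝔤 ↔ IsCompactLie 𝔥 := by
  have key : ∀ {𝔤 𝔥 : Type} [LieRing 𝔤] [LieAlgebra ℝ 𝔤] [LieRing 𝔥] [LieAlgebra ℝ 𝔥]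
      (_ : 𝔤 ≃ₗ⁅ℝ⁆ 𝔥), IsCompactLie 𝔥 → IsCompactLie 𝔤 := by
    intro 𝔤 𝔥 _ _ _ _ h hc x hx
    rw [← LieAlgebra.killingForm_of_equiv_apply h]
    exact hc _ fun h0 => hx (h.injective (h0.trans h.toLieHom.map_zero.symm))
  exact ⟨key h.symm, key h⟩

/-- A `CartanModel` from trace identities for matrices. -/
noncomputable def CartanModel.ofTrace {φ : Form 3} {𝔤 : Type} [LieRing 𝔤] [LieAlgebra ℝ 𝔤]
    (j : ComplexModel 𝔤) (f : V ≃ₗ[ℝ] 𝔤) {κ b : ℝ} (hκ : κ ≠ 0) (hb : b ≠ 0)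
    (hφ : ∀ X Y Z, (φ ![X, Y, Z] : ℂ) = κ * ((j.toMatrix (f X) * j.toMatrix (f Y) -
      j.toMatrix (f Y) * j.toMatrix (f X)) * j.toMatrix (f Z)).trace)
    (hB : ∀ ρ X Y, (reducedTraceForm φ ρ X Y : ℂ) =
      scale ρ ^ 2 * b * (j.toMatrix (f X) * j.toMatrix (f Y)).trace) : CartanModel φ 𝔤 where
  equiv := f
  -- In a `ComplexModel` the Killing form is `6` times the trace form of the matrices.
  formFactor := κ / 6
  traceFactor := b / 6
  formFactor_ne_zero := div_ne_zero hκ (by norm_num)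
  traceFactor_ne_zero := div_ne_zero hb (by norm_num)
  form_eq X Y Z := by
    apply Complex.ofReal_injective
    push_cast
    rw [hφ, j.killingForm_eq, j.map_lie]
    ring
  trace_eq ρ X Y := by
    apply Complex.ofReal_injective
    push_cast
    rw [hB, j.killingForm_eq]
    ring

/-! ### Computation with monomials -/

/-- The product of the signs of `b - a`, for the entries `b` of a list. -/
def compareProd (a : Fin 8) : List (Fin 8) → ℤ
  | [] => 1
  | b :: l => bif Nat.beq a.val b.val then 0 else
      bif Nat.ble a.val b.val then compareProd a l else -compareProd a l

/-- The sign of a list: zero if there are repetitions, else the sign of the permutation that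
sorts the list. -/
def listSign : List (Fin 8) → ℤ
  | [] => 1
  | a :: l => if compareProd a l = 0 then 0 else compareProd a l * listSign l

theorem compareProd_ofFn (a : Fin 8) {n : ℕ} (l : Fin n → Fin 8) :
    compareProd a (List.ofFn l) =
      ∏ j, if a = l j then (0 : ℤ) else if a < l j then 1 else -1 := by
  induction n with
  | zero => simp [compareProd]
  | succ n ih =>
    rw [List.ofFn_succ, compareProd, Fin.prod_univ_succ, ih]
    rcases lt_trichotomy a (l 0) with h | h | h
    · have h1 : Nat.beq a.val (l 0).val = false := by
        rw [← Bool.not_eq_true, Nat.beq_eq]; exact (Fin.lt_def.mp h).ne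
      have h2 : Nat.ble a.val (l 0).val = true := Nat.ble_eq.mpr (Fin.lt_def.mp h).le
      rw [h1, h2, if_neg h.ne, if_pos h, one_mul, cond_false, cond_true]
    · have h1 : Nat.beq a.val (l 0).val = true := Nat.beq_eq.mpr (congrArg Fin.val h)
      rw [h1, if_pos h, zero_mul, cond_true]
    · have h1 : Nat.beq a.val (l 0).val = false := by
        rw [← Bool.not_eq_true, Nat.beq_eq]; exact (Fin.lt_def.mp h).ne'
      have h2 : Nat.ble a.val (l 0).val = false := by
        rw [← Bool.not_eq_true, Nat.ble_eq]; exact (Fin.lt_def.mp h).not_ge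
      rw [h1, h2, if_neg h.ne', if_neg h.not_gt, neg_one_mul, cond_false, cond_false]

theorem compareProd_append (a : Fin 8) (l l' : List (Fin 8)) :
    compareProd a (l ++ l') = compareProd a l * compareProd a l' := by
  induction l with
  | nil => simp [compareProd]
  | cons b l ih =>
    rw [List.cons_append, compareProd, compareProd, ih]
    cases Nat.beq a.val b.val <;> cases Nat.ble a.val b.val <;> simp

/-- Justifies the early exit in `structureConstant`: a repetition among the first four indices kills
the whole monomial. -/
theorem listSign_append_eq_zero {l : List (Fin 8)} (l' : List (Fin 8)) (h : listSign l = 0) :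
    listSign (l ++ l') = 0 := by
  induction l with
  | nil => simp [listSign] at h
  | cons a l ih =>
    rw [List.cons_append, listSign, compareProd_append]
    rw [listSign] at h
    split_ifs at h with h0
    · simp [h0]
    · rw [ih ((mul_eq_zero.mp h).resolve_left h0)]
      simp

theorem listSign_ofFn {n : ℕ} (l : Fin n → Fin 8) : listSign (List.ofFn l) =
    ∏ i, ∏ j ∈ Finset.Ioi i, if l i = l j then (0 : ℤ) else if l i < l j then 1 else -1 := by
  induction n with
  | zero => simp [listSign]
  | succ n ih =>
    rw [List.ofFn_succ, listSign, Fin.prod_univ_succ, Fin.prod_Ioi_zero, ih]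
    simp only [Fin.prod_Ioi_succ, compareProd_ofFn]
    split_ifs with h
    · rw [h, zero_mul]
    · rfl

theorem vol_mono_eq_listSign (l : Fin 8 → Fin 8) : vol (mono l) = (listSign (List.ofFn l) : ℝ) := by
  rw [vol_mono, listSign_ofFn]

/-- The 3-form with the given monomials. -/
noncomputable def ofMonomials (D : List (ℤ × Fin 8 × Fin 8 × Fin 8)) : Form 3 :=
  (D.map fun t => (t.1 : ℝ) • mono ![t.2.1, t.2.2.1, t.2.2.2]).sum

/-- The monomials of the contraction of a 3-form with a basis vector. -/
def contraction (D : List (ℤ × Fin 8 × Fin 8 × Fin 8)) (p : Fin 8) : List (ℤ × Fin 8 × Fin 8) :=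
  D.flatMap fun t => (if t.2.1 = p then [(t.1, t.2.2.1, t.2.2.2)] else []) ++
    ((if t.2.2.1 = p then [(-t.1, t.2.1, t.2.2.2)] else []) ++
      (if t.2.2.2 = p then [(t.1, t.2.1, t.2.2.1)] else []))

theorem curryLeft_ofMonomials (D : List (ℤ × Fin 8 × Fin 8 × Fin 8)) (p : Fin 8) :
    (ofMonomials D).curryLeft (Pi.single p 1) =
      ((contraction D p).map fun t => (t.1 : ℝ) • mono ![t.2.1, t.2.2]).sum := by
  induction D with
  | nil => simp [ofMonomials, contraction]
  | cons t D ih =>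
    rw [ofMonomials, List.map_cons, List.sum_cons, AlternatingMap.curryLeft_add,
      LinearMap.add_apply, ← ofMonomials, ih]
    conv_rhs => rw [contraction, List.flatMap_cons, List.map_append, List.sum_append,
      ← contraction]
    congr 1
    rw [AlternatingMap.curryLeft_smul, LinearMap.smul_apply, curryLeft_mono3]
    simp only [Pi.single_apply, List.map_append, List.sum_append]
    split_ifs <;> simp [sub_eq_add_neg, add_assoc]

/-- The structure constants of the multiplication, in terms of monomials. -/
def structureConstant (D : List (ℤ × Fin 8 × Fin 8 × Fin 8)) (p q i : Fin 8) : ℤ :=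
  -((contraction D p).map fun a => ((contraction D q).map fun b =>
    if listSign [a.2.1, a.2.2, b.2.1, b.2.2] = 0 then 0 else (D.map fun c => a.1 * (b.1 * (c.1 *
      listSign [a.2.1, a.2.2, b.2.1, b.2.2, c.2.1, c.2.2.1, c.2.2.2, i]))).sum).sum).sum

theorem vol_wedge_mono (a b : Fin 2 → Fin 8) (c : Fin 3 → Fin 8) (i : Fin 8) :
    vol (wedge 7 1 (wedge 4 3 (wedge 2 2 (mono a) (mono b)) (mono c)) (coord i)) =
      (listSign [a 0, a 1, b 0, b 1, c 0, c 1, c 2, i] : ℝ) := by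
  rw [coord_eq_mono, mono_finAppend, mono_finAppend, mono_finAppend, vol_mono_eq_listSign]
  rfl

/-- `vol`, as a linear map. -/
noncomputable def volHom : Form 8 →ₗ[ℝ] ℝ := evalForm (Pi.basisFun ℝ (Fin 8))

theorem volHom_apply (ω : Form 8) : volHom ω = vol ω := rfl

theorem vol_wedge_sum_left {α : Type} (P : List α) (f : α → Form 2) (b : Form 2) (c : Form 3)
    (d : Form 1) : volHom (wedge 7 1 (wedge 4 3 (wedge 2 2 (P.map f).sum b) c) d) =
      (P.map fun a => volHom (wedge 7 1 (wedge 4 3 (wedge 2 2 (f a) b) c) d)).sum := by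
  induction P with
  | nil => simp
  | cons a P ih => simp only [List.map_cons, List.sum_cons, map_add, LinearMap.add_apply, ih]

theorem vol_wedge_sum_middle {α : Type} (Q : List α) (f : α → Form 2) (a : Form 2) (c : Form 3)
    (d : Form 1) : volHom (wedge 7 1 (wedge 4 3 (wedge 2 2 a (Q.map f).sum) c) d) =
      (Q.map fun b => volHom (wedge 7 1 (wedge 4 3 (wedge 2 2 a (f b)) c) d)).sum := by
  induction Q with
  | nil => simp
  | cons b Q ih => simp only [List.map_cons, List.sum_cons, map_add, LinearMap.add_apply, ih]

theorem vol_wedge_sum_right {α : Type} (D : List α) (f : α → Form 3) (a b : Form 2)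
    (d : Form 1) : volHom (wedge 7 1 (wedge 4 3 (wedge 2 2 a b) (D.map f).sum) d) =
      (D.map fun c => volHom (wedge 7 1 (wedge 4 3 (wedge 2 2 a b) (f c)) d)).sum := by
  induction D with
  | nil => simp
  | cons c D ih => simp only [List.map_cons, List.sum_cons, map_add, LinearMap.add_apply, ih]

/-- Multilinearity of the wedge product reduces each structure constant to a sum of signs of index
lists, an integer that can be evaluated. -/
theorem reducedMul_ofMonomials (D : List (ℤ × Fin 8 × Fin 8 × Fin 8)) (ρ : ⋀[ℝ]^8 V)
    (p q i : Fin 8) : reducedMul (ofMonomials D) ρ (Pi.single p 1) (Pi.single q 1) i =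
      scale ρ * structureConstant D p q i := by
  have key : vol (topForm (ofMonomials D) (Pi.single p 1) (Pi.single q 1) i) =
      -(structureConstant D p q i : ℝ) := by
    rw [topForm, curryLeft_ofMonomials, curryLeft_ofMonomials, ofMonomials, structureConstant,
      ← volHom_apply, vol_wedge_sum_left]
    simp only [Int.cast_neg, neg_neg, Int.cast_list_sum, List.map_map, Function.comp_def]
    refine congrArg List.sum (List.map_congr_left fun a _ => ?_)
    rw [vol_wedge_sum_middle]
    refine congrArg List.sum (List.map_congr_left fun b _ => ?_)
    rw [vol_wedge_sum_right]
    have h0 : (if listSign [a.2.1, a.2.2, b.2.1, b.2.2] = 0 then 0 else (D.map fun c => a.1 *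
        (b.1 * (c.1 * listSign [a.2.1, a.2.2, b.2.1, b.2.2, c.2.1, c.2.2.1, c.2.2.2, i]))).sum) =
        (D.map fun c => a.1 * (b.1 * (c.1 *
          listSign [a.2.1, a.2.2, b.2.1, b.2.2, c.2.1, c.2.2.1, c.2.2.2, i]))).sum := by
      split_ifs with h
      · have h1 : ∀ c : ℤ × Fin 8 × Fin 8 × Fin 8,
            listSign [a.2.1, a.2.2, b.2.1, b.2.2, c.2.1, c.2.2.1, c.2.2.2, i] = 0 := fun c =>
          listSign_append_eq_zero [c.2.1, c.2.2.1, c.2.2.2, i] h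
        simp [h1]
      · rfl
    rw [h0, Int.cast_list_sum, List.map_map]
    refine congrArg List.sum (List.map_congr_left fun c _ => ?_)
    simp only [map_smul, LinearMap.smul_apply, smul_eq_mul, volHom_apply, vol_wedge_mono]
    simp only [Matrix.cons_val_zero, Matrix.cons_val_one, Matrix.cons_val, Function.comp_apply,
      Int.cast_mul]
    ring
  rw [reducedMul_apply, key]
  ring

/-- The structure constant stored in a table. -/
def lookup (T : Fin 8 → List (Fin 8 × Fin 8 × ℤ)) (p q i : Fin 8) : ℤ :=
  ((T p).map fun t => if t.1 = q ∧ t.2.1 = i then t.2.2 else 0).sum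

theorem sum_lookup_mul (T : Fin 8 → List (Fin 8 × Fin 8 × ℤ)) (p : Fin 8)
    (f : Fin 8 → Fin 8 → ℤ) : ∑ i, ∑ j, lookup T p j i * f i j =
      ((T p).map fun t => t.2.2 * f t.2.1 t.1).sum := by
  unfold lookup
  induction T p with
  | nil => simp
  | cons t l ih =>
    simp only [List.map_cons, List.sum_cons, add_mul, Finset.sum_add_distrib, ih, ite_mul,
      zero_mul]
    congr 1
    rw [Finset.sum_eq_single t.2.1, Finset.sum_eq_single t.1]
    · simp
    · intro j _ hj
      simp [hj.symm]
    · simp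
    · intro i _ hi
      simp [hi.symm]
    · simp

/-- Leaves two finite integer checks, the table `T` and its contraction `G`. As `lookup` is sparse,
each trace sum of 64 terms shrinks to one term per table entry. -/
theorem reducedTraceForm_ofMonomials {D : List (ℤ × Fin 8 × Fin 8 × Fin 8)}
    {T : Fin 8 → List (Fin 8 × Fin 8 × ℤ)} {G : Fin 8 → Fin 8 → ℤ}
    (hT : ∀ p q i, structureConstant D p q i = lookup T p q i)
    (hG : ∀ p q, ((T p).map fun t => t.2.2 * lookup T q t.2.1 t.1).sum = G p q)
    (ρ : ⋀[ℝ]^8 V) (X Y : V) : reducedTraceForm (ofMonomials D) ρ X Y =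
      scale ρ ^ 2 * ∑ p, ∑ q, X p * Y q * G p q := by
  have h : ∀ p q, reducedTraceForm (ofMonomials D) ρ (Pi.single p 1) (Pi.single q 1) =
      scale ρ ^ 2 * G p q := by
    intro p q
    simp only [reducedTraceForm_eq_sum, reducedMul_ofMonomials, hT, ← hG,
      ← sum_lookup_mul T p fun i j => lookup T q i j]
    push_cast
    simp only [Finset.mul_sum]
    refine Finset.sum_congr rfl fun i _ => Finset.sum_congr rfl fun j _ => ?_
    ring
  have hs : ∀ x : V, x = ∑ i, x i • (Pi.single i 1 : V) := fun x => by
    ext k; simp [Finset.sum_apply, Pi.single_apply]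
  conv_lhs => rw [hs X, hs Y]
  simp only [map_sum, map_smul, LinearMap.sum_apply, LinearMap.smul_apply, smul_eq_mul, h,
    Finset.mul_sum]
  rw [Finset.sum_comm]
  refine Finset.sum_congr rfl fun p _ => Finset.sum_congr rfl fun q _ => ?_
  ring

/-! ### The trace forms of the three 3-forms -/

/-- The monomials of `φ₁`. -/
def monomials₁ : List (ℤ × Fin 8 × Fin 8 × Fin 8) :=
  [(1, 0, 1, 3), (1, 0, 2, 3), (1, 1, 4, 5), (1, 2, 6, 7), (1, 0, 4, 6), (1, 3, 5, 7)]

/-- The non-zero structure constants of the multiplication defined by `φ₁`. -/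
def structureConstants₁ : Fin 8 → List (Fin 8 × Fin 8 × ℤ) :=
  -- A triple `(q, i, c)` in row `p` records the coefficient `c` of `e_i` in the product of `e_p`
  -- and `e_q`.
  ![[(1, 0, -1), (2, 0, 1), (3, 1, 3), (3, 2, -3), (4, 7, -3), (6, 5, -3)],
    [(0, 0, -1), (1, 1, -2), (2, 1, -2), (2, 2, 2), (3, 3, -1), (4, 4, -1), (5, 5, -1), (6, 6, 2),
      (7, 7, 2)],
    [(0, 0, 1), (1, 1, -2), (1, 2, 2), (2, 2, 2), (3, 3, 1), (4, 4, -2), (5, 5, -2), (6, 6, 1),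
      (7, 7, 1)],
    [(0, 1, 3), (0, 2, -3), (1, 3, -1), (2, 3, 1), (5, 6, 3), (7, 4, 3)],
    [(0, 7, -3), (1, 4, -1), (2, 4, -2), (5, 2, 3), (6, 3, -3)],
    [(1, 5, -1), (2, 5, -2), (3, 6, 3), (4, 2, 3), (7, 0, 3)],
    [(0, 5, -3), (1, 6, 2), (2, 6, 1), (4, 3, -3), (7, 1, -3)],
    [(1, 7, 2), (2, 7, 1), (3, 4, 3), (5, 0, 3), (6, 1, -3)]]

/-- The Gram matrix of the trace form of `φ₁`. -/
def gram₁ : Fin 8 → Fin 8 → ℤ :=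
  ![![0, 0, 0, -30, 0, 0, 0, 0],
    ![0, 20, 10, 0, 0, 0, 0, 0],
    ![0, 10, 20, 0, 0, 0, 0, 0],
    ![-30, 0, 0, 0, 0, 0, 0, 0],
    ![0, 0, 0, 0, 0, -30, 0, 0],
    ![0, 0, 0, 0, -30, 0, 0, 0],
    ![0, 0, 0, 0, 0, 0, 0, -30],
    ![0, 0, 0, 0, 0, 0, -30, 0]]

theorem φ₁_eq : φ₁ = ofMonomials monomials₁ := by
  simp [φ₁, ofMonomials, monomials₁, e_eq_mono, add_assoc]

theorem reducedTraceForm_φ₁ (ρ : ⋀[ℝ]^8 V) (X Y : V) : reducedTraceForm φ₁ ρ X Y =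
    scale ρ ^ 2 * ∑ p, ∑ q, X p * Y q * gram₁ p q := by
  rw [φ₁_eq]
  exact reducedTraceForm_ofMonomials (T := structureConstants₁) (by decide +kernel)
    (by decide +kernel) ρ X Y

/-- The monomials of `φ₂`. -/
def monomials₂ : List (ℤ × Fin 8 × Fin 8 × Fin 8) :=
  [(1, 0, 2, 4), (1, 1, 3, 4), (1, 0, 3, 5), (-1, 1, 2, 5), (1, 0, 1, 6), (1, 2, 3, 7),
    (1, 5, 6, 7)]

/-- The non-zero structure constants of the multiplication defined by `φ₂`. -/
def structureConstants₂ : Fin 8 → List (Fin 8 × Fin 8 × ℤ) :=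
  ![[(0, 7, 6), (2, 5, -3), (3, 4, 3), (4, 0, -1), (5, 1, 3), (6, 3, -3)],
    [(1, 7, 6), (2, 4, -3), (3, 5, -3), (4, 1, -1), (5, 0, -3), (6, 2, 3)],
    [(0, 5, -3), (1, 4, -3), (2, 6, 6), (4, 2, -1), (5, 3, -3), (7, 1, 3)],
    [(0, 4, 3), (1, 5, -3), (3, 6, 6), (4, 3, -1), (5, 2, 3), (7, 0, -3)],
    [(0, 0, -1), (1, 1, -1), (2, 2, -1), (3, 3, -1), (4, 4, -2), (5, 5, 2), (6, 6, 2), (7, 7, 2)],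
    [(0, 1, 3), (1, 0, -3), (2, 3, -3), (3, 2, 3), (4, 5, 2), (5, 4, -6)],
    [(0, 3, -3), (1, 2, 3), (4, 6, 2), (7, 4, 3)],
    [(2, 1, 3), (3, 0, -3), (4, 7, 2), (6, 4, 3)]]

/-- The Gram matrix of the trace form of `φ₂`. -/
def gram₂ : Fin 8 → Fin 8 → ℤ :=
  ![![0, 0, 0, -60, 0, 0, 0, 0],
    ![0, 0, 60, 0, 0, 0, 0, 0],
    ![0, 60, 0, 0, 0, 0, 0, 0],
    ![-60, 0, 0, 0, 0, 0, 0, 0],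
    ![0, 0, 0, 0, 20, 0, 0, 0],
    ![0, 0, 0, 0, 0, -60, 0, 0],
    ![0, 0, 0, 0, 0, 0, 0, 30],
    ![0, 0, 0, 0, 0, 0, 30, 0]]

theorem φ₂_eq : φ₂ = ofMonomials monomials₂ := by
  simp [φ₂, ofMonomials, monomials₂, e_eq_mono, sub_eq_add_neg, add_assoc]

theorem reducedTraceForm_φ₂ (ρ : ⋀[ℝ]^8 V) (X Y : V) : reducedTraceForm φ₂ ρ X Y =
    scale ρ ^ 2 * ∑ p, ∑ q, X p * Y q * gram₂ p q := by
  rw [φ₂_eq]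
  exact reducedTraceForm_ofMonomials (T := structureConstants₂) (by decide +kernel)
    (by decide +kernel) ρ X Y

/-- The monomials of `φ₃`. -/
def monomials₃ : List (ℤ × Fin 8 × Fin 8 × Fin 8) :=
  [(1, 0, 2, 4), (-1, 0, 3, 5), (1, 1, 2, 5), (1, 1, 3, 4), (1, 2, 3, 6),
    (1, 4, 5, 7), (1, 0, 1, 6), (1, 0, 1, 7)]

/-- The non-zero structure constants of the multiplication defined by `φ₃`. -/
def structureConstants₃ : Fin 8 → List (Fin 8 × Fin 8 × ℤ) :=
  ![[(0, 6, 6), (0, 7, -6), (2, 5, 3), (3, 4, 3), (4, 3, 3), (5, 2, 3), (6, 0, 1), (7, 0, -1)],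
    [(1, 6, 6), (1, 7, -6), (2, 4, -3), (3, 5, 3), (4, 2, -3), (5, 3, 3), (6, 1, 1), (7, 1, -1)],
    [(0, 5, 3), (1, 4, -3), (2, 7, 6), (4, 1, -3), (5, 0, 3), (6, 2, 1), (7, 2, 2)],
    [(0, 4, 3), (1, 5, 3), (3, 7, 6), (4, 0, 3), (5, 1, 3), (6, 3, 1), (7, 3, 2)],
    [(0, 3, 3), (1, 2, -3), (2, 1, -3), (3, 0, 3), (4, 6, -6), (6, 4, -2), (7, 4, -1)],
    [(0, 2, 3), (1, 3, 3), (2, 0, 3), (3, 1, 3), (5, 6, -6), (6, 5, -2), (7, 5, -1)],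
    [(0, 0, 1), (1, 1, 1), (2, 2, 1), (3, 3, 1), (4, 4, -2), (5, 5, -2), (6, 6, 2), (7, 6, 2),
      (7, 7, -2)],
    [(0, 0, -1), (1, 1, -1), (2, 2, 2), (3, 3, 2), (4, 4, -1), (5, 5, -1), (6, 6, 2), (6, 7, -2),
      (7, 7, -2)]]

/-- The Gram matrix of the trace form of `φ₃`. -/
def gram₃ : Fin 8 → Fin 8 → ℤ :=
  ![![60, 0, 0, 0, 0, 0, 0, 0],
    ![0, 60, 0, 0, 0, 0, 0, 0],
    ![0, 0, 60, 0, 0, 0, 0, 0],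
    ![0, 0, 0, 60, 0, 0, 0, 0],
    ![0, 0, 0, 0, 60, 0, 0, 0],
    ![0, 0, 0, 0, 0, 60, 0, 0],
    ![0, 0, 0, 0, 0, 0, 20, 10],
    ![0, 0, 0, 0, 0, 0, 10, 20]]

theorem φ₃_eq : φ₃ = ofMonomials monomials₃ := by
  simp [φ₃, ofMonomials, monomials₃, e_eq_mono, sub_eq_add_neg, add_assoc]

theorem reducedTraceForm_φ₃ (ρ : ⋀[ℝ]^8 V) (X Y : V) : reducedTraceForm φ₃ ρ X Y =
    scale ρ ^ 2 * ∑ p, ∑ q, X p * Y q * gram₃ p q := by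
  rw [φ₃_eq]
  exact reducedTraceForm_ofMonomials (T := structureConstants₃) (by decide +kernel)
    (by decide +kernel) ρ X Y

/-! ### The three real forms of `sl(3, ℂ)` -/

theorem matrix_ext_fin_three {R : Type*} {A B : Matrix (Fin 3) (Fin 3) R}
    (h00 : A 0 0 = B 0 0) (h01 : A 0 1 = B 0 1) (h02 : A 0 2 = B 0 2)
    (h10 : A 1 0 = B 1 0) (h11 : A 1 1 = B 1 1) (h12 : A 1 2 = B 1 2)
    (h20 : A 2 0 = B 2 0) (h21 : A 2 1 = B 2 1) (h22 : A 2 2 = B 2 2) : A = B := by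
  ext i k
  fin_cases i <;> fin_cases k <;> assumption

/-- The matrix in `sl(3, ℝ)` with the given coordinates. -/
noncomputable def matrix₁ (x : V) : Matrix (Fin 3) (Fin 3) ℝ :=
  -- The coordinates `x 1`, `x 2` are the differences of consecutive diagonal entries (the simple
  -- roots); the others are root coordinates, with signs such that `φ₁` becomes exactly `tr ([X, Y]
  -- Z)`.
  !![(2 * x 1 + x 2) / 3, x 5, -x 0;
    -x 4, (x 2 - x 1) / 3, x 7;
    x 3, -x 6, -(x 1 + 2 * x 2) / 3]

/-- Coordinates on `sl(3, ℝ)`. -/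
noncomputable def equiv₁ : V ≃ₗ[ℝ] sl3R where
  toFun x := ⟨matrix₁ x, by
    change (matrix₁ x).trace = 0
    simp only [Matrix.trace_fin_three, matrix₁, Matrix.of_apply, Matrix.cons_val]
    ring⟩
  map_add' x y := by
    apply Subtype.ext
    change matrix₁ (x + y) = matrix₁ x + matrix₁ y
    apply matrix_ext_fin_three <;> simp [matrix₁] <;> ring
  map_smul' c x := by
    apply Subtype.ext
    change matrix₁ (c • x) = c • matrix₁ x
    apply matrix_ext_fin_three <;> simp [matrix₁] <;> ring
  invFun A := ![-A.val 0 2, A.val 0 0 - A.val 1 1, A.val 1 1 - A.val 2 2, A.val 2 0, -A.val 1 0,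
    A.val 0 1, -A.val 2 1, A.val 1 2]
  left_inv x := by
    ext i
    fin_cases i <;> simp [matrix₁] <;> ring
  right_inv A := by
    have h : A.val.trace = 0 := A.2
    rw [Matrix.trace_fin_three] at h
    apply Subtype.ext
    apply matrix_ext_fin_three <;> simp [matrix₁] <;> linarith

theorem φ₁_eq_trace (X Y Z : V) : φ₁ ![X, Y, Z] =
    ((matrix₁ X * matrix₁ Y - matrix₁ Y * matrix₁ X) * matrix₁ Z).trace := by
  simp only [φ₁, e_eq_mono, AlternatingMap.add_apply, mono_apply, Matrix.det_fin_three,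
    Matrix.trace_fin_three, Matrix.mul_apply, Matrix.sub_apply, Fin.sum_univ_three, matrix₁,
    Matrix.of_apply, Matrix.cons_val]
  ring

theorem reducedTraceForm_φ₁_eq_trace (ρ : ⋀[ℝ]^8 V) (X Y : V) : reducedTraceForm φ₁ ρ X Y =
    scale ρ ^ 2 * 30 * (matrix₁ X * matrix₁ Y).trace := by
  rw [reducedTraceForm_φ₁]
  simp only [Fin.sum_univ_eight, gram₁, Matrix.trace_fin_three, Matrix.mul_apply,
    Fin.sum_univ_three, matrix₁, Matrix.of_apply, Matrix.cons_val, Int.cast_zero, Int.cast_neg,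
    Int.cast_ofNat]
  ring

/-- `φ₁` as a Cartan 3-form. -/
noncomputable def cartanModel₁ : CartanModel φ₁ sl3R :=
  .ofTrace sl3RModel equiv₁ (κ := 1) (b := 30) one_ne_zero (by norm_num)
    (fun X Y Z => by
      rw [φ₁_eq_trace]
      change _ = (1 : ℝ) * (((matrix₁ X).map Complex.ofRealHom * (matrix₁ Y).map Complex.ofRealHom -
        (matrix₁ Y).map Complex.ofRealHom * (matrix₁ X).map Complex.ofRealHom) *
          (matrix₁ Z).map Complex.ofRealHom).trace
      rw [← Matrix.map_mul, ← Matrix.map_mul, ← Matrix.map_sub _ (map_sub _), ← Matrix.map_mul,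
        ← AddMonoidHom.map_trace, Complex.ofReal_one, one_mul]
      rfl)
    (fun ρ X Y => by
      rw [reducedTraceForm_φ₁_eq_trace]
      change _ = (scale ρ : ℂ) ^ 2 * (30 : ℝ) * ((matrix₁ X).map Complex.ofRealHom *
        (matrix₁ Y).map Complex.ofRealHom).trace
      rw [← Matrix.map_mul, ← AddMonoidHom.map_trace]
      push_cast
      rfl)

/-- The equations that define `su(J)`, for a diagonal matrix `J`. -/
theorem mem_su_diagonal_iff {d : Fin 3 → ℝ} {A : Matrix (Fin 3) (Fin 3) ℂ} :
    A ∈ su (Matrix.diagonal fun i => (d i : ℂ)) ↔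
      (∀ i k, (A k i).re * d k + d i * (A i k).re = 0 ∧
        (A k i).im * d k = d i * (A i k).im) ∧
      A 0 0 + A 1 1 + A 2 2 = 0 := by
  rw [mem_su_iff, Matrix.trace_fin_three]
  refine and_congr_left fun _ => ?_
  rw [← Matrix.ext_iff]
  refine forall_congr' fun i => forall_congr' fun k => ?_
  rw [Matrix.add_apply, Matrix.mul_diagonal, Matrix.diagonal_mul, Matrix.conjTranspose_apply,
    Matrix.zero_apply, Complex.ext_iff]
  simp [neg_add_eq_zero]

theorem su3_eq : su3 = su (Matrix.diagonal fun i => ((![1, 1, 1] : Fin 3 → ℝ) i : ℂ)) := by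
  rw [su3]
  congr 1
  apply matrix_ext_fin_three <;> simp

theorem su12_eq : su12 = su (Matrix.diagonal fun i => ((![1, -1, -1] : Fin 3 → ℝ) i : ℂ)) := by
  rw [su12]
  congr 2
  funext i
  fin_cases i <;> simp

/-- The matrix in `su(3)` with the given coordinates. -/
noncomputable def matrix₃ (x : V) : Matrix (Fin 3) (Fin 3) ℂ :=
  !![⟨0, (2 * x 6 + x 7) / 3⟩, ⟨x 2, x 3⟩, ⟨x 0, x 1⟩;
    ⟨-x 2, x 3⟩, ⟨0, (x 7 - x 6) / 3⟩, ⟨x 4, x 5⟩;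
    ⟨-x 0, x 1⟩, ⟨-x 4, x 5⟩, ⟨0, -(x 6 + 2 * x 7) / 3⟩]

/-- Coordinates on `su(3)`. -/
noncomputable def equiv₃ : V ≃ₗ[ℝ] su3 where
  toFun x := ⟨matrix₃ x, by
    rw [su3_eq, mem_su_diagonal_iff]
    constructor
    · intro i k
      fin_cases i <;> fin_cases k <;> simp [matrix₃]
    · apply Complex.ext <;> simp [matrix₃]
      ring⟩
  map_add' x y := by
    apply Subtype.ext
    change matrix₃ (x + y) = matrix₃ x + matrix₃ y
    apply matrix_ext_fin_three <;> apply Complex.ext <;> simp [matrix₃] <;> ring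
  map_smul' c x := by
    apply Subtype.ext
    change matrix₃ (c • x) = c • matrix₃ x
    apply matrix_ext_fin_three <;> apply Complex.ext <;> simp [matrix₃] <;> ring
  invFun A := ![(A.val 0 2).re, (A.val 0 2).im, (A.val 0 1).re, (A.val 0 1).im, (A.val 1 2).re,
    (A.val 1 2).im, (A.val 0 0).im - (A.val 1 1).im, (A.val 1 1).im - (A.val 2 2).im]
  left_inv x := by
    ext i
    fin_cases i <;> simp [matrix₃] <;> ring
  right_inv A := by
    obtain ⟨A, h⟩ := A
    have h' := h
    rw [su3_eq, mem_su_diagonal_iff] at h'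
    obtain ⟨h', ht⟩ := h'
    have ht := congrArg Complex.im ht
    have h00 := h' 0 0
    have h01 := h' 0 1
    have h02 := h' 0 2
    have h11 := h' 1 1
    have h12 := h' 1 2
    have h22 := h' 2 2
    clear h'
    simp only [Matrix.cons_val] at h00 h01 h02 h11 h12 h22
    simp only [Complex.add_im, Complex.zero_im] at ht
    apply Subtype.ext
    apply matrix_ext_fin_three <;> apply Complex.ext <;> simp [matrix₃] <;> linarith

theorem φ₃_eq_trace (X Y Z : V) : (φ₃ ![X, Y, Z] : ℂ) = ((-1 / 2 : ℝ) : ℂ) *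
    ((matrix₃ X * matrix₃ Y - matrix₃ Y * matrix₃ X) * matrix₃ Z).trace := by
  apply Complex.ext <;>
  simp only [φ₃, e_eq_mono, AlternatingMap.add_apply, AlternatingMap.sub_apply, mono_apply,
    Matrix.det_fin_three, Matrix.trace_fin_three, Matrix.mul_apply, Matrix.sub_apply,
    Fin.sum_univ_three, matrix₃, Matrix.of_apply, Matrix.cons_val, Complex.ofReal_re,
    Complex.ofReal_im, Complex.mul_re, Complex.mul_im, Complex.add_re, Complex.add_im,
    Complex.sub_re, Complex.sub_im] <;>
  ring

theorem reducedTraceForm_φ₃_eq_trace (ρ : ⋀[ℝ]^8 V) (X Y : V) :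
    (reducedTraceForm φ₃ ρ X Y : ℂ) =
      scale ρ ^ 2 * ((-30 : ℝ) : ℂ) * (matrix₃ X * matrix₃ Y).trace := by
  rw [reducedTraceForm_φ₃, ← Complex.ofReal_pow, ← Complex.ofReal_mul]
  apply Complex.ext <;>
  simp only [Fin.sum_univ_eight, gram₃, Matrix.trace_fin_three, Matrix.mul_apply,
    Fin.sum_univ_three, matrix₃, Matrix.of_apply, Matrix.cons_val, Int.cast_zero, Int.cast_ofNat,
    Complex.ofReal_re, Complex.ofReal_im, Complex.mul_re, Complex.mul_im,
    Complex.add_re, Complex.add_im] <;>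
  ring

/-- The inclusion of `su(3)` into `sl(3, ℂ)`. -/
noncomputable def complexModel₃ : ComplexModel su3 :=
  suModel 1 (by simp) (by simp) (by rw [← equiv₃.finrank_eq]; simp)

/-- `φ₃` as a Cartan 3-form. -/
noncomputable def cartanModel₃ : CartanModel φ₃ su3 :=
  .ofTrace complexModel₃ equiv₃ (κ := -1 / 2) (b := -30) (by norm_num) (by norm_num)
    φ₃_eq_trace reducedTraceForm_φ₃_eq_trace

/-- The matrix in `su(1, 2)` with the given coordinates. -/
noncomputable def matrix₂ (x : V) : Matrix (Fin 3) (Fin 3) ℂ :=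
  -- The upper left block is `su(1, 1)`, with coordinates `x 5`, `x 6`, `x 7`, plus the direction `x
  -- 4` commuting with it; `x 6` and `x 7` multiply nilpotent matrices, in accordance with the zeros
  -- on the diagonal of `gram₂`.
  !![⟨0, x 4 / 3 - x 6 / 4 - x 7⟩, ⟨x 5, x 6 / 4 - x 7⟩, ⟨x 1 - x 2 / 2, -x 0 - x 3 / 2⟩;
    ⟨x 5, x 7 - x 6 / 4⟩, ⟨0, x 4 / 3 + x 6 / 4 + x 7⟩, ⟨-x 1 - x 2 / 2, x 0 - x 3 / 2⟩;
    ⟨x 1 - x 2 / 2, x 0 + x 3 / 2⟩, ⟨x 1 + x 2 / 2, x 0 - x 3 / 2⟩, ⟨0, -2 * x 4 / 3⟩]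

/-- Coordinates on `su(1, 2)`. -/
noncomputable def equiv₂ : V ≃ₗ[ℝ] su12 where
  toFun x := ⟨matrix₂ x, by
    rw [su12_eq, mem_su_diagonal_iff]
    constructor
    · intro i k
      fin_cases i <;> fin_cases k <;> simp [matrix₂] <;> ring
    · apply Complex.ext <;> simp [matrix₂]
      ring⟩
  map_add' x y := by
    apply Subtype.ext
    change matrix₂ (x + y) = matrix₂ x + matrix₂ y
    apply matrix_ext_fin_three <;> apply Complex.ext <;> simp [matrix₂] <;> ring
  map_smul' c x := by
    apply Subtype.ext
    change matrix₂ (c • x) = c • matrix₂ x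
    apply matrix_ext_fin_three <;> apply Complex.ext <;> simp [matrix₂] <;> ring
  invFun A := ![((A.val 1 2).im - (A.val 0 2).im) / 2, ((A.val 0 2).re - (A.val 1 2).re) / 2,
    -((A.val 0 2).re + (A.val 1 2).re), -((A.val 0 2).im + (A.val 1 2).im),
    -3 / 2 * (A.val 2 2).im, (A.val 0 1).re,
    (A.val 1 1).im - (A.val 0 0).im + 2 * (A.val 0 1).im,
    ((A.val 1 1).im - (A.val 0 0).im) / 4 - (A.val 0 1).im / 2]
  left_inv x := by
    ext i
    fin_cases i <;> simp [matrix₂] <;> ring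
  right_inv A := by
    obtain ⟨A, h⟩ := A
    have h' := h
    rw [su12_eq, mem_su_diagonal_iff] at h'
    obtain ⟨h', ht⟩ := h'
    have ht := congrArg Complex.im ht
    have h00 := h' 0 0
    have h01 := h' 0 1
    have h02 := h' 0 2
    have h11 := h' 1 1
    have h12 := h' 1 2
    have h22 := h' 2 2
    clear h'
    simp only [Matrix.cons_val] at h00 h01 h02 h11 h12 h22
    simp only [Complex.add_im, Complex.zero_im] at ht
    apply Subtype.ext
    apply matrix_ext_fin_three <;> apply Complex.ext <;> simp [matrix₂] <;> linarith

theorem φ₂_eq_trace (X Y Z : V) : (φ₂ ![X, Y, Z] : ℂ) = ((-1 / 2 : ℝ) : ℂ) *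
    ((matrix₂ X * matrix₂ Y - matrix₂ Y * matrix₂ X) * matrix₂ Z).trace := by
  apply Complex.ext <;>
  simp only [φ₂, e_eq_mono, AlternatingMap.add_apply, AlternatingMap.sub_apply, mono_apply,
    Matrix.det_fin_three, Matrix.trace_fin_three, Matrix.mul_apply, Matrix.sub_apply,
    Fin.sum_univ_three, matrix₂, Matrix.of_apply, Matrix.cons_val, Complex.ofReal_re,
    Complex.ofReal_im, Complex.mul_re, Complex.mul_im, Complex.add_re, Complex.add_im,
    Complex.sub_re, Complex.sub_im] <;>
  ring

theorem reducedTraceForm_φ₂_eq_trace (ρ : ⋀[ℝ]^8 V) (X Y : V) :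
    (reducedTraceForm φ₂ ρ X Y : ℂ) =
      scale ρ ^ 2 * ((-30 : ℝ) : ℂ) * (matrix₂ X * matrix₂ Y).trace := by
  rw [reducedTraceForm_φ₂, ← Complex.ofReal_pow, ← Complex.ofReal_mul]
  apply Complex.ext <;>
  simp only [Fin.sum_univ_eight, gram₂, Matrix.trace_fin_three, Matrix.mul_apply,
    Fin.sum_univ_three, matrix₂, Matrix.of_apply, Matrix.cons_val, Int.cast_zero, Int.cast_neg,
    Int.cast_ofNat, Complex.ofReal_re, Complex.ofReal_im, Complex.mul_re, Complex.mul_im,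
    Complex.add_re, Complex.add_im] <;>
  ring

theorem diagonal_signature_mul_self :
    (Matrix.diagonal ![1, -1, -1] : Matrix (Fin 3) (Fin 3) ℂ) * Matrix.diagonal ![1, -1, -1] =
      1 := by
  rw [Matrix.diagonal_mul_diagonal, ← Matrix.diagonal_one]
  congr 1
  funext i
  fin_cases i <;> simp

theorem diagonal_signature_conjTranspose :
    (Matrix.diagonal ![1, -1, -1] : Matrix (Fin 3) (Fin 3) ℂ).conjTranspose =
      Matrix.diagonal ![1, -1, -1] := by
  rw [Matrix.diagonal_conjTranspose]
  congr 1
  funext i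
  fin_cases i <;> simp

/-- The inclusion of `su(1, 2)` into `sl(3, ℂ)`. -/
noncomputable def complexModel₂ : ComplexModel su12 :=
  suModel _ diagonal_signature_conjTranspose diagonal_signature_mul_self
    (by rw [← equiv₂.finrank_eq]; simp)

/-- `φ₂` as a Cartan 3-form. -/
noncomputable def cartanModel₂ : CartanModel φ₂ su12 :=
  .ofTrace complexModel₂ equiv₂ (κ := -1 / 2) (b := -30) (by norm_num) (by norm_num)
    φ₂_eq_trace reducedTraceForm_φ₂_eq_trace

/-! ### Compactness and the main theorem -/

/-- For skew-Hermitian `x`, `6 tr (x ^ 2) = -6 tr (x x^*)`, which is `-6` times the sum of the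
squared moduli of the entries. -/
theorem isCompactLie_su3 : IsCompactLie su3 := by
  intro x hx
  have hs : x.val.conjTranspose = -x.val := by
    have h : x.val.conjTranspose * 1 + 1 * x.val = 0 := x.2.1
    rw [mul_one, one_mul] at h
    exact eq_neg_of_add_eq_zero_left h
  have h := complexModel₃.killingForm_eq x x
  change _ = 6 * (x.val * x.val).trace at h
  have h2 : x.val * x.val = -(x.val * x.val.conjTranspose) := by rw [hs]; simp
  have h3 : (x.val * x.val.conjTranspose).trace =
      ((∑ i, ∑ k, Complex.normSq (x.val i k) : ℝ) : ℂ) := by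
    simp [Matrix.trace, Matrix.mul_apply, Complex.mul_conj]
  rw [h2, Matrix.trace_neg, h3] at h
  have h4 : killingForm ℝ su3 x x = 6 * -∑ i, ∑ k, Complex.normSq (x.val i k) := by
    apply Complex.ofReal_injective
    rw [h]
    push_cast
    rfl
  rw [h4]
  have h5 : 0 < ∑ i, ∑ k, Complex.normSq (x.val i k) := by
    refine lt_of_le_of_ne
      (Finset.sum_nonneg fun i _ => Finset.sum_nonneg fun k _ => Complex.normSq_nonneg _)
      fun h0 => hx (Subtype.ext (Matrix.ext fun i k => ?_))
    have h6 := (Finset.sum_eq_zero_iff_of_nonneg fun i _ =>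
      Finset.sum_nonneg fun k _ => Complex.normSq_nonneg _).mp h0.symm i (Finset.mem_univ i)
    have h7 := (Finset.sum_eq_zero_iff_of_nonneg fun k _ => Complex.normSq_nonneg _).mp h6 k
      (Finset.mem_univ k)
    exact Complex.normSq_eq_zero.mp h7
  linarith

theorem ComplexModel.not_isCompactLie {𝔤 : Type} [LieRing 𝔤] [LieAlgebra ℝ 𝔤]
    (j : ComplexModel 𝔤) (x : 𝔤) (h : (j.toMatrix x * j.toMatrix x).trace = 2) :
    ¬ IsCompactLie 𝔤 := by
  intro hc
  have h1 := j.killingForm_eq x x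
  rw [h] at h1
  have h2 : killingForm ℝ 𝔤 x x = 12 := by
    apply Complex.ofReal_injective
    rw [h1]
    norm_num
  have hx : x ≠ 0 := by
    rintro rfl
    rw [map_zero, zero_mul, Matrix.trace_zero] at h
    norm_num at h
  have h3 := hc x hx
  rw [h2] at h3
  norm_num at h3

theorem not_isCompactLie_sl3R : ¬ IsCompactLie sl3R := by
  -- This is the symmetric matrix `E₀₁ + E₁₀`, whose square has trace `2`; the same matrix serves
  -- for `su(1, 2)`.
  refine sl3RModel.not_isCompactLie (equiv₁ ![0, 0, 0, 0, -1, 1, 0, 0]) ?_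
  change ((matrix₁ _).map Complex.ofRealHom * (matrix₁ _).map Complex.ofRealHom).trace = 2
  rw [← Matrix.map_mul, ← AddMonoidHom.map_trace, Matrix.trace_fin_three]
  simp [matrix₁, Matrix.mul_apply, Fin.sum_univ_three]
  norm_num

theorem not_isCompactLie_su12 : ¬ IsCompactLie su12 := by
  refine complexModel₂.not_isCompactLie (equiv₂ ![0, 0, 0, 0, 0, 1, 0, 0]) ?_
  change (matrix₂ _ * matrix₂ _).trace = 2
  rw [Matrix.trace_fin_three]
  apply Complex.ext <;> simp [matrix₂, Matrix.mul_apply, Fin.sum_univ_three]; norm_num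

end StableForm

open StableForm

theorem proposition3p11 :
    -- every stable 3-form defines a Lie algebra structure, whichever reduced trace form is used
    (∀ φ : Form 3, IsStable φ → ∀ ρ : ⋀[ℝ]^8 V, ρ ≠ 0 →
      (reducedTraceForm φ ρ).Nondegenerate ∧
      ∃! L : LieStructure V, IsBracketOf φ ρ L) ∧
    -- the three forms are stable
    (IsStable φ₁ ∧ IsStable φ₂ ∧ IsStable φ₃) ∧
    -- the Lie algebras which they define
    (∀ (ρ : ⋀[ℝ]^8 V), ρ ≠ 0 → ∀ L : LieStructure V,
      (IsBracketOf φ₁ ρ L →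
        IsRealFormOfSl3C L.Carrier ∧ ¬ IsCompactLie L.Carrier ∧
        Nonempty (L.Carrier ≃ₗ⁅ℝ⁆ sl3R) ∧ IsMultipleOfCartanForm φ₁ L) ∧
      (IsBracketOf φ₂ ρ L →
        IsRealFormOfSl3C L.Carrier ∧ ¬ IsCompactLie L.Carrier ∧
        Nonempty (L.Carrier ≃ₗ⁅ℝ⁆ su12) ∧ IsMultipleOfCartanForm φ₂ L) ∧
      (IsBracketOf φ₃ ρ L →
        IsRealFormOfSl3C L.Carrier ∧ IsCompactLie L.Carrier ∧
        Nonempty (L.Carrier ≃ₗ⁅ℝ⁆ su3) ∧ IsMultipleOfCartanForm φ₃ L)) ∧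
    -- up to a linear change of coordinates they are the Cartan 3-forms
    (IsEquivalentToCartanForm sl3R φ₁ ∧
      IsEquivalentToCartanForm su12 φ₂ ∧
      IsEquivalentToCartanForm su3 φ₃) := by
  have k₁ := sl3RModel.isKilling
  have k₂ := complexModel₂.isKilling
  have k₃ := complexModel₃.isKilling
  -- The reference form for all stable 3-forms is `φ₁`; either of the other two would do.
  refine ⟨fun φ hφ ρ hρ => hφ.existsUnique_isBracketOf cartanModel₁.isStable
      (cartanModel₁.nondegenerate hρ) (cartanModel₁.isBracketOf hρ),
    ⟨cartanModel₁.isStable, cartanModel₂.isStable, cartanModel₃.isStable⟩,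
    fun ρ hρ L => ⟨fun hL => ?_, fun hL => ?_, fun hL => ?_⟩,
    cartanModel₁.isEquivalentToCartanForm, cartanModel₂.isEquivalentToCartanForm,
    cartanModel₃.isEquivalentToCartanForm⟩
  · let g := cartanModel₁.lieEquiv hρ hL
    exact ⟨(sl3RModel.comp g).isRealForm, (isCompactLie_congr g).not.mpr not_isCompactLie_sl3R,
      ⟨g⟩, cartanModel₁.isMultipleOfCartanForm hρ hL⟩
  · let g := cartanModel₂.lieEquiv hρ hL
    exact ⟨(complexModel₂.comp g).isRealForm,
      (isCompactLie_congr g).not.mpr not_isCompactLie_su12,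
      ⟨g⟩, cartanModel₂.isMultipleOfCartanForm hρ hL⟩
  · let g := cartanModel₃.lieEquiv hρ hL
    exact ⟨(complexModel₃.comp g).isRealForm, (isCompactLie_congr g).mpr isCompactLie_su3,
      ⟨g⟩, cartanModel₃.isMultipleOfCartanForm hρ hL⟩
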